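/- Let $N\ge 0$ be an integer, $\mathbb K$ a field, and let $X=(x_1,\dots,x_{N-1})$ and $Y=(y_1,\dots,y_{N-2})$ be sequences of elements of $\mathbb K$. The Okada algebra $O_N(X,Y)$ is the unital associative $\mathbb K$-algebra with generators $e_1,\dots,e_{N-1}$ and relations $e_i^2=x_ie_i$ for $1\le i\le N-1$, $e_ie_j=e_je_i$ for $|i-j|\ge 2$, and $e_{i+1}e_ie_{i+1}=y_ie_{i+1}$ for $1\le i\le N-2$. Order the $2N$ nodes as $1<2<\dots<N<\overline N<\dots<\overline 2<\overline 1$, with $1,\dots,N$ on the left boundary and $\overline 1,\dots,\overline N$ on the right boundary of a rectangle, and put $|a|=|\overline a|=a$. An Okada arc-diagram of rank $N$ is a non-crossing perfect matching of the nodes in which every arc $\{a,b\}$ carries an integer label $\mathbf h(\{a,b\})$ with $1\le \mathbf h(\{a,b\})\le\min(|a|,|b|)$ and $\mathbf h(\{a,b\})\equiv\min(|a|,|b|) \pmod 2$, such that $\mathbf h(\{a,b\})>\mathbf h(\{c,d\})$ whenever $c<a<b<d$. For two such diagrams $C,D$, the composition $C\circ D$ is obtained by merging the right nodes of $C$ with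 the left nodes of $D$ and concatenating arcs; the label of each resulting arc or loop is the minimum of the labels of the arcs that comprise it. Let $[C\circ D]$ be the labelled diagram obtained by removing all loops, and let $\ell_k$ be the number of loops with label $k$. For a diagram $D$ and $1\le j\le N-1$ let $n_j(D)$ be half the number of nodes $a$ with $h\le j<|a|$, where $h$ is the label of the arc that ends in $a$. Let $\mathrm{OkArc}_N(X,Y)$ be the $\mathbb K$-vector space with the Okada arc-diagrams of rank $N$ as basis, with the bilinear product $$C\cdot D=\Big(\prod_{k=1}^{N-1}x_k^{\ell_k}\Big)\Big(\prod_{i=1}^{N-2}y_i^{m_i}\Big)[C\circ D],\qquad m_i=\sum_{j=i+1}^{N-1}(-1)^{j-i-1}\big(n_j(C)+n_j(D)-n_j([C\circ D])-\ell_j\big).$$ (For $Y=(1,\dots,1)$ this is $\prod_k x_k^{\ell_k}\,[C\circ D]$.) Let $\mathrm{id}_N$ be the diagram with arcs $\{a,\overline a\}$ labelled $a$, for $1\le a\le N$. For $1\le i\le N-1$ let the elementary diagram $g_i$ be the one with the arcs $\{i,i+1\}$ and $\{\overline i,\overline{i+1}\}$, both labelled $i$, and the arcs $\{j,\overline j\}$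 labelled $j$ for $j\ne i,i+1$. Theorem. The composition $[C\circ D]$ of two Okada arc-diagrams is an Okada arc-diagram, and $\mathrm{OkArc}_N(X,Y)$ is an associative algebra with unit $\mathrm{id}_N$. Its dimension is $N!$, and it is generated as a unital algebra by the elementary diagrams $g_1,\dots,g_{N-1}$. Furthermore, the assignment $e_i\mapsto g_i$ extends to a unique unital algebra homomorphism $\Theta:O_N(X,Y)\to\mathrm{OkArc}_N(X,Y)$, and $\Theta$ is an isomorphism. -/

import Mathlib

/-! ### The Okada algebra by generators and relations

The sequences `X = (x_1, …, x_{N-1})` and `Y = (y_1, …, y_{N-2})` are functions on `Fin (N - 1)`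
and `Fin (N - 2)`; the index `i` of `Fin` stands for the index `i + 1`. -/

/-- The defining relations of the Okada algebra. -/
inductive OkadaRel {K : Type*} [Field K] (N : ℕ) (X : Fin (N - 1) → K) (Y : Fin (N - 2) → K) :
    FreeAlgebra K (Fin (N - 1)) → FreeAlgebra K (Fin (N - 1)) → Prop
  | sq (i : Fin (N - 1)) :
      OkadaRel N X Y (FreeAlgebra.ι K i * FreeAlgebra.ι K i) (X i • FreeAlgebra.ι K i)
  | comm (i j : Fin (N - 1)) (h : i.val + 2 ≤ j.val ∨ j.val + 2 ≤ i.val) :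
      OkadaRel N X Y (FreeAlgebra.ι K i * FreeAlgebra.ι K j)
        (FreeAlgebra.ι K j * FreeAlgebra.ι K i)
  | shift (i : Fin (N - 2)) (lo hi : Fin (N - 1)) (hlo : lo.val = i.val)
      (hhi : hi.val = i.val + 1) :
      OkadaRel N X Y (FreeAlgebra.ι K hi * FreeAlgebra.ι K lo * FreeAlgebra.ι K hi)
        (Y i • FreeAlgebra.ι K hi)

/-- The Okada algebra `O_N(X, Y)`: the unital associative `K`-algebra presented by the generators
`e_1, …, e_{N-1}` and the relations `OkadaRel`. -/
abbrev OkadaAlgebra {K : Type*} [Field K] (N : ℕ) (X : Fin (N - 1) → K) (Y : Fin (N - 2) → K) :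
    Type _ :=
  RingQuot (OkadaRel N X Y)

/-- The generators `e_i` of the Okada algebra. -/
noncomputable def OkadaAlgebra.e {K : Type*} [Field K] {N : ℕ} (X : Fin (N - 1) → K)
    (Y : Fin (N - 2) → K) (i : Fin (N - 1)) : OkadaAlgebra N X Y :=
  RingQuot.mkAlgHom K (OkadaRel N X Y) (FreeAlgebra.ι K i)

/-! ### Height-labelled arc-diagrams -/

/-- The boundary nodes: `Sum.inl i` is the node `i + 1` on the left boundary, `Sum.inr i` is the
overlined node `i + 1` on the right boundary. -/
abbrev ArcNode (N : ℕ) : Type := Fin N ⊕ Fin N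

/-- The absolute value `|a|` of a node. -/
def ArcNode.level {N : ℕ} : ArcNode N → ℕ
  | Sum.inl i => i.val + 1
  | Sum.inr i => i.val + 1

/-- The position of a node in the total order in which `1, …, N` come first, in this order,
followed by the overlined `N, …, 1`, in this order. -/
def ArcNode.pos {N : ℕ} : ArcNode N → ℕ
  | Sum.inl i => i.val
  | Sum.inr i => 2 * N - 1 - i.val

/-- A graph on the boundary nodes, whose edges are the arcs, with a label at each node:
`height a` is the label of the arc that ends in `a`. -/
@[ext]
structure LabelledArcs (N : ℕ) where
  graph : SimpleGraph (ArcNode N)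
  height : ArcNode N → ℕ

/-- The conditions for labelled arcs to be an Okada arc-diagram of rank `N`: the arcs are a
non-crossing perfect matching, and the labels satisfy the three height conditions. -/
structure LabelledArcs.IsOkada {N : ℕ} (D : LabelledArcs N) : Prop where
  matching : ∀ a, ∃! b, D.graph.Adj a b
  noncrossing : ∀ a b c d, D.graph.Adj a c → D.graph.Adj b d →
    ¬ (a.pos < b.pos ∧ b.pos < c.pos ∧ c.pos < d.pos)
  height_eq : ∀ a b, D.graph.Adj a b → D.height a = D.height b
  one_le_height : ∀ a, 1 ≤ D.height a
  height_le : ∀ a b, D.graph.Adj a b → D.height a ≤ min a.level b.level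
  parity : ∀ a b, D.graph.Adj a b → D.height a ≡ min a.level b.level [MOD 2]
  nested : ∀ a b c d, D.graph.Adj a b → D.graph.Adj c d →
    c.pos < a.pos → a.pos < b.pos → b.pos < d.pos → D.height c < D.height a

/-- The set of Okada arc-diagrams of rank `N`. -/
abbrev OkadaDiagram (N : ℕ) : Type := {D : LabelledArcs N // D.IsOkada}

/-! ### Composition of diagrams -/

namespace LabelledArcs

variable {N : ℕ}

/-- The nodes of `C` in the composition `C ∘ D`, whose nodes form three columns: the left
boundary, the middle column where the two diagrams are merged, and the right boundary. -/
def nodeFst : ArcNode N → Fin 3 × Fin N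
  | Sum.inl i => (0, i)
  | Sum.inr i => (1, i)

/-- The nodes of `D` in the composition `C ∘ D`. -/
def nodeSnd : ArcNode N → Fin 3 × Fin N
  | Sum.inl i => (1, i)
  | Sum.inr i => (2, i)

/-- The boundary nodes of the composition `C ∘ D`. -/
def nodeOuter : ArcNode N → Fin 3 × Fin N
  | Sum.inl i => (0, i)
  | Sum.inr i => (2, i)

/-- The arc fragments of `C` and `D`, concatenated. The arcs and the loops of `C ∘ D` are the
connected components of this graph. -/
def glue (C D : LabelledArcs N) : SimpleGraph (Fin 3 × Fin N) :=
  C.graph.map nodeFst ⊔ D.graph.map nodeSnd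

/-- The height label of an arc or loop of `C ∘ D`: the minimum of the labels of the arc fragments
that comprise it. -/
noncomputable def compHeight (C D : LabelledArcs N) (γ : (glue C D).ConnectedComponent) : ℕ :=
  sInf ({h | ∃ a, (glue C D).connectedComponentMk (nodeFst a) = γ ∧ C.height a = h} ∪
    {h | ∃ a, (glue C D).connectedComponentMk (nodeSnd a) = γ ∧ D.height a = h})

/-- The labelled arcs `[C ∘ D]`, obtained from `C ∘ D` by removing all loops. -/
noncomputable def comp (C D : LabelledArcs N) : LabelledArcs N where
  graph :=
    { Adj := fun a b => a ≠ b ∧ (glue C D).Reachable (nodeOuter a) (nodeOuter b)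
      symm := ⟨fun _ _ h => ⟨h.1.symm, h.2.symm⟩⟩
      loopless := ⟨fun _ h => h.1 rfl⟩ }
  height := fun a => compHeight C D ((glue C D).connectedComponentMk (nodeOuter a))

/-- The number `ℓ_k` of loops of `C ∘ D` with height label `k`; a loop is a component that contains
no boundary node. -/
noncomputable def loops (C D : LabelledArcs N) (k : ℕ) : ℕ :=
  Set.ncard {γ : (glue C D).ConnectedComponent |
    (∀ a, (glue C D).connectedComponentMk (nodeOuter a) ≠ γ) ∧ compHeight C D γ = k}

/-- The number of boxes (double U-turns) in row `j` of the normal form of a diagram. In normal form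
an arc descends from each of its two ends `a` to the level given by its height, so it passes between
the levels `j` and `j + 1` once for each end `a` with `height a ≤ j < |a|`; a box in row `j` consists
of two such passages. -/
noncomputable def boxes (D : LabelledArcs N) (j : ℕ) : ℕ :=
  Set.ncard {a : ArcNode N | D.height a ≤ j ∧ j < a.level} / 2

/-- The exponent `m_i` of `y_i` in the product of `C` and `D`, that is, the number of rewriting
moves `e_{i+1} e_i e_{i+1} ⟼ y_i e_{i+1}` that bring `C ∘ D` to normal form. Such a move removes one
box in each of the rows `i` and `i + 1`, and the removal of a loop of height `j`, with weight `x_j`,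
removes one box in row `j`. So
`m_{j-1} + m_j = boxes C j + boxes D j - boxes [C ∘ D] j - ℓ_j` for `1 ≤ j ≤ N - 1`, with
`m_{N-1} = 0`; the alternating sum is the solution of these equations. -/
noncomputable def yExp (C D : LabelledArcs N) (i : ℕ) : ℕ :=
  (∑ j ∈ Finset.Ico (i + 1) N, (-1 : ℤ) ^ (j - (i + 1)) *
    ((boxes C j : ℤ) + boxes D j - boxes (comp C D) j - loops C D j)).toNat

/-- The scalar `∏ x_k ^ ℓ_k * ∏ y_i ^ m_i` of the product of `C` and `D`. -/
noncomputable def weight {K : Type*} [Field K] (X : Fin (N - 1) → K) (Y : Fin (N - 2) → K)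
    (C D : LabelledArcs N) : K :=
  (∏ k : Fin (N - 1), X k ^ loops C D (k.val + 1)) *
    ∏ i : Fin (N - 2), Y i ^ yExp C D (i.val + 1)

end LabelledArcs

/-! ### The identity diagram and the elementary diagrams -/

namespace OkadaDiagram

/-- The identity diagram: the arcs join `a` to the overlined `a`, with label `a`. -/
def id (N : ℕ) : OkadaDiagram N where
  val :=
    { graph := SimpleGraph.fromRel fun a b => ∃ j, a = Sum.inl j ∧ b = Sum.inr j
      height := ArcNode.level }
  property := by
    constructor
    · rintro (a | a)
      · exact ⟨Sum.inr a, by simp, by rintro (b | b) <;> simp [eq_comm]⟩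
      · exact ⟨Sum.inl a, by simp, by rintro (b | b) <;> simp [eq_comm]⟩
    all_goals
      simp only [SimpleGraph.fromRel_adj]
      first
      | (rintro (a | a) <;> simp [ArcNode.level]; done)
      | (rintro (a | a) (b | b) <;> simp [ArcNode.level, Nat.ModEq] <;> grind)
      | (rintro (a | a) (b | b) (c | c) (d | d) <;> simp [ArcNode.level, ArcNode.pos] <;> grind)

/-- The labelled arcs of `g_i` (with the index `i + 1` written for `i : Fin (N - 1)`): the nodes
`i` and `i + 1`, and the overlined `i` and `i + 1`, are joined by arcs with label `i`; every other
`j` is joined to the overlined `j` with label `j`. -/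
def gArcs {N : ℕ} (i : Fin (N - 1)) : LabelledArcs N where
  graph := SimpleGraph.fromRel fun a b =>
    (∃ j : Fin N, j.val ≠ i.val ∧ j.val ≠ i.val + 1 ∧ a = Sum.inl j ∧ b = Sum.inr j) ∨
    (∃ j k : Fin N, j.val = i.val ∧ k.val = i.val + 1 ∧ a = Sum.inl j ∧ b = Sum.inl k) ∨
    (∃ j k : Fin N, j.val = i.val ∧ k.val = i.val + 1 ∧ a = Sum.inr j ∧ b = Sum.inr k)
  height := fun a => if a.level = i.val + 2 then i.val + 1 else a.level

theorem gArcs_height {N : ℕ} (i : Fin (N - 1)) (a : ArcNode N) :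
    (a.level = i.val + 2 ∧ (gArcs i).height a = i.val + 1) ∨
      (a.level ≠ i.val + 2 ∧ (gArcs i).height a = a.level) := by
  simp only [gArcs]
  split_ifs with h <;> simp [h]

theorem gArcs_adj {N : ℕ} (i : Fin (N - 1)) {a b : ArcNode N} (h : (gArcs i).graph.Adj a b) :
    1 ≤ a.level ∧ a.level ≤ N ∧ 1 ≤ b.level ∧ b.level ≤ N ∧
    ((a.level = b.level ∧ a.level ≠ i.val + 1 ∧ a.level ≠ i.val + 2 ∧
      ((a.pos + 1 = a.level ∧ b.pos + b.level = 2 * N) ∨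
        (b.pos + 1 = b.level ∧ a.pos + a.level = 2 * N))) ∨
    (((a.level = i.val + 1 ∧ b.level = i.val + 2) ∨ (a.level = i.val + 2 ∧ b.level = i.val + 1)) ∧
      ((a.pos + 1 = a.level ∧ b.pos + 1 = b.level) ∨
        (a.pos + a.level = 2 * N ∧ b.pos + b.level = 2 * N)))) := by
  have hi := i.isLt
  rw [gArcs, SimpleGraph.fromRel_adj] at h
  obtain ⟨-, (⟨j, h1, h2, rfl, rfl⟩ | ⟨j, k, h1, h2, rfl, rfl⟩ | ⟨j, k, h1, h2, rfl, rfl⟩) |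
    (⟨j, h1, h2, rfl, rfl⟩ | ⟨j, k, h1, h2, rfl, rfl⟩ | ⟨j, k, h1, h2, rfl, rfl⟩)⟩ := h <;>
  simp [ArcNode.level, ArcNode.pos] <;> omega

theorem pos_level {N : ℕ} (a : ArcNode N) :
    1 ≤ a.level ∧ a.level ≤ N ∧ (a.pos + 1 = a.level ∨ a.pos + a.level = 2 * N) := by
  rcases a with a | a <;> simp [ArcNode.level, ArcNode.pos] <;> omega

theorem pos_injective {N : ℕ} {a b : ArcNode N} (h : a.pos = b.pos) : a = b := by
  rcases a with a | a <;> rcases b with b | b <;> simp only [ArcNode.pos] at h <;>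
    simp only [Sum.inl.injEq, Sum.inr.injEq, reduceCtorEq] <;> omega

theorem gArcs_exists {N : ℕ} (i : Fin (N - 1)) (a : ArcNode N) :
    ∃ b, (gArcs i).graph.Adj a b := by
  have hi := i.isLt
  simp only [gArcs, SimpleGraph.fromRel_adj]
  rcases a with a | a
  · by_cases h0 : a.val = i.val
    · exact ⟨Sum.inl ⟨i.val + 1, by omega⟩, by simp [Fin.ext_iff, h0],
        Or.inl (Or.inr (Or.inl ⟨_, _, h0, rfl, rfl, rfl⟩))⟩
    by_cases h1 : a.val = i.val + 1
    · exact ⟨Sum.inl ⟨i.val, by omega⟩, by simp [Fin.ext_iff, h1],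
        Or.inr (Or.inr (Or.inl ⟨⟨i.val, by omega⟩, a, rfl, h1, rfl, rfl⟩))⟩
    exact ⟨Sum.inr a, by simp, Or.inl (Or.inl ⟨a, h0, h1, rfl, rfl⟩)⟩
  · by_cases h0 : a.val = i.val
    · exact ⟨Sum.inr ⟨i.val + 1, by omega⟩, by simp [Fin.ext_iff, h0],
        Or.inl (Or.inr (Or.inr ⟨_, _, h0, rfl, rfl, rfl⟩))⟩
    by_cases h1 : a.val = i.val + 1
    · exact ⟨Sum.inr ⟨i.val, by omega⟩, by simp [Fin.ext_iff, h1],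
        Or.inr (Or.inr (Or.inr ⟨⟨i.val, by omega⟩, a, rfl, h1, rfl, rfl⟩))⟩
    exact ⟨Sum.inl a, by simp, Or.inr (Or.inl ⟨a, h0, h1, rfl, rfl⟩)⟩

/-- The elementary diagram `g_i`. -/
def g {N : ℕ} (i : Fin (N - 1)) : OkadaDiagram N where
  val := gArcs i
  property := by
    have hi := i.isLt
    constructor
    · intro a
      obtain ⟨b, hb⟩ := gArcs_exists i a
      refine ⟨b, hb, fun c hc => pos_injective ?_⟩
      have := gArcs_adj i hb
      have := gArcs_adj i hc
      omega
    · intro a b c d hac hbd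
      have := gArcs_adj i hac
      have := gArcs_adj i hbd
      omega
    · intro a b h
      have := gArcs_adj i h
      have := gArcs_height i a
      have := gArcs_height i b
      omega
    · intro a
      have := pos_level a
      have := gArcs_height i a
      omega
    · intro a b h
      have := gArcs_adj i h
      have := gArcs_height i a
      omega
    · intro a b h
      have := gArcs_adj i h
      have := gArcs_height i a
      unfold Nat.ModEq
      omega
    · intro a b c d hab hcd h1 h2 h3
      have := gArcs_adj i hab
      have := gArcs_adj i hcd
      have := gArcs_height i a
      have := gArcs_height i c
      omega

end OkadaDiagram

/-! ### The diagram algebra -/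

/-- The vector space `OkArc_N(X, Y)` with the Okada arc-diagrams of rank `N` as basis; the
parameters enter through the product. -/
def OkArc {K : Type*} [Field K] (N : ℕ) (_X : Fin (N - 1) → K) (_Y : Fin (N - 2) → K) : Type _ :=
  OkadaDiagram N →₀ K

namespace OkArc

variable {K : Type*} [Field K] {N : ℕ} (X : Fin (N - 1) → K) (Y : Fin (N - 2) → K)

noncomputable instance : AddCommGroup (OkArc N X Y) :=
  inferInstanceAs (AddCommGroup (OkadaDiagram N →₀ K))

noncomputable instance : Module K (OkArc N X Y) :=
  inferInstanceAs (Module K (OkadaDiagram N →₀ K))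

/-- A diagram as an element of `OkArc_N(X, Y)`. -/
noncomputable def diagram (D : OkadaDiagram N) : OkArc N X Y :=
  Finsupp.single D (1 : K)

open Classical in
/-- The product of two diagrams, `weight C D • [C ∘ D]`. (That `[C ∘ D]` is always an Okada
arc-diagram, so that the second case does not occur, is part of the theorem.) -/
noncomputable def mulDiagram (C D : OkadaDiagram N) : OkArc N X Y :=
  if h : (LabelledArcs.comp C.1 D.1).IsOkada then
    LabelledArcs.weight X Y C.1 D.1 • diagram X Y ⟨LabelledArcs.comp C.1 D.1, h⟩
  else 0

/-- The bilinear extension of the product of diagrams. -/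
noncomputable def mulHom : OkArc N X Y →ₗ[K] OkArc N X Y →ₗ[K] OkArc N X Y :=
  Finsupp.linearCombination K fun C : OkadaDiagram N =>
    (Finsupp.linearCombination K fun D : OkadaDiagram N => mulDiagram X Y C D :
      OkArc N X Y →ₗ[K] OkArc N X Y)

noncomputable instance : NonUnitalNonAssocRing (OkArc N X Y) where
  mul a b := mulHom X Y a b
  left_distrib a b c := map_add (mulHom X Y a) b c
  right_distrib a b c := LinearMap.congr_fun (map_add (mulHom X Y) a b) c
  zero_mul a := LinearMap.congr_fun (map_zero (mulHom X Y)) a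
  mul_zero a := map_zero (mulHom X Y a)

instance : IsScalarTower K (OkArc N X Y) (OkArc N X Y) where
  smul_assoc r a b := LinearMap.congr_fun (map_smul (mulHom X Y) r a) b

instance : SMulCommClass K (OkArc N X Y) (OkArc N X Y) where
  smul_comm r a b := (map_smul (mulHom X Y a) r b).symm

noncomputable instance : One (OkArc N X Y) where
  one := diagram X Y (OkadaDiagram.id N)

end OkArc

/-!
Glue labelled graphs along part of their boundary and contract the result to the remaining boundary,
where a component is labelled by the minimum of its labels. Contracting in two stages is the same as
contracting at once. For three diagrams glued in a row this gives associativity of the composition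
and the cocycle identity for the number of loops, and the exponents of `y` inherit the latter, since
the remaining terms in their definition are coboundaries.

The composition of `g_i` with a diagram `D` is explicit: the nodes `i` and `i + 1` are paired, and
so are their former partners. Conversely, a diagram other than the identity is `g_i ∘ D'` for a
diagram `D'` with a greater sum of labels, and this product has coefficient `1`: let `k` be the
greatest level with a label that is not maximal, and `i` the greatest level below it at which the
left label is maximal. Then `i` is joined to `i + 1`, and `D'` joins `i + 1` with the maximal label
to `i + 2` or, if `i + 1 = k`, to the overlined node `i + 1`. By induction all diagrams are products
of the `g_i`, and closure under composition is reduced to products with `g_i`. So is the fact that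
the exponents of `y` are not negative, which makes their truncation harmless.

For a fixed `k`, composition with `g_i` injects the diagrams with the level `i + 1` in place of `i`
into those with the level `i`, so each of the `k` possible levels occurs at least as often as the
last one, and there are at least `N!` diagrams. On the other side, `N!` words in the generators span
the Okada algebra. As `Θ` is surjective, both dimensions are `N!` and `Θ` is bijective.
-/

/-! ### Gluing labelled graphs -/

/-- A graph in which each vertex carries a set of labels. The composition of arc-diagrams is an
instance of gluing such graphs and contracting the result to its boundary. -/
@[ext]
structure LabelledGraph (V : Type*) where
  graph : SimpleGraph V
  labels : V → Set ℕ

namespace LabelledGraph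

open SimpleGraph

variable {A B V V₁ V₂ W : Type*}

instance : Max (LabelledGraph V) where
  max G H := ⟨G.graph ⊔ H.graph, fun v => G.labels v ∪ H.labels v⟩

/-- The image of a labelled graph under a map of its vertices. -/
def map (f : V → W) (G : LabelledGraph V) : LabelledGraph W where
  graph := G.graph.map f
  labels w := {h | ∃ v, f v = w ∧ h ∈ G.labels v}

/-- The minimal label of a connected component. -/
noncomputable def minLabel (G : LabelledGraph V) (γ : G.graph.ConnectedComponent) : ℕ :=
  sInf {h | ∃ v, G.graph.connectedComponentMk v = γ ∧ h ∈ G.labels v}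

/-- The contraction of `G` to a family `b` of boundary vertices: two boundary vertices are joined if
they lie in the same component of `G`, and they carry the minimal label of this component. -/
noncomputable def contract (G : LabelledGraph V) (b : B → V) : LabelledGraph B where
  graph :=
    { Adj := fun β β' => β ≠ β' ∧ G.graph.Reachable (b β) (b β')
      symm := ⟨fun _ _ h => ⟨h.1.symm, h.2.symm⟩⟩
      loopless := ⟨fun _ h => h.1 rfl⟩ }
  labels β := {G.minLabel (G.graph.connectedComponentMk (b β))}

/-- The components with minimal label `k` that contain none of the boundary vertices `b`. -/
def closedComponents (G : LabelledGraph V) (b : B → V) (k : ℕ) : Set G.graph.ConnectedComponent :=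
  {γ | (∀ β, G.graph.connectedComponentMk (b β) ≠ γ) ∧ G.minLabel γ = k}

theorem sup_assoc (G H K : LabelledGraph V) : (G ⊔ H) ⊔ K = G ⊔ (H ⊔ K) :=
  LabelledGraph.ext (_root_.sup_assoc ..) (funext fun _ => Set.union_assoc ..)

theorem sup_comm (G H : LabelledGraph V) : G ⊔ H = H ⊔ G :=
  LabelledGraph.ext (_root_.sup_comm ..) (funext fun _ => Set.union_comm ..)

theorem map_sup (f : V → W) (G H : LabelledGraph V) : (G ⊔ H).map f = G.map f ⊔ H.map f := by
  apply LabelledGraph.ext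
  · ext u v
    change ((G.graph ⊔ H.graph).map f).Adj u v ↔ (G.graph.map f ⊔ H.graph.map f).Adj u v
    simp only [map_adj', sup_adj]
    grind
  · ext w h
    change (∃ v, f v = w ∧ (h ∈ G.labels v ∨ h ∈ H.labels v)) ↔
      (∃ v, f v = w ∧ h ∈ G.labels v) ∨ ∃ v, f v = w ∧ h ∈ H.labels v
    grind

theorem map_map (f : V → V₁) (f' : V₁ → W) (G : LabelledGraph V) :
    (G.map f).map f' = G.map (f' ∘ f) := by
  apply LabelledGraph.ext
  · exact SimpleGraph.map_map _ f f'
  · ext w h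
    simp [map]

theorem exists_minLabel_mem {G : LabelledGraph V} (hG : ∀ v, (G.labels v).Nonempty) (v : V) :
    ∃ u, G.graph.Reachable v u ∧ G.minLabel (G.graph.connectedComponentMk v) ∈ G.labels u := by
  obtain ⟨h, hh⟩ := hG v
  obtain ⟨u, hu, hm⟩ := Nat.sInf_mem
    (s := {h | ∃ u, G.graph.connectedComponentMk u = G.graph.connectedComponentMk v ∧
      h ∈ G.labels u}) ⟨h, v, rfl, hh⟩
  exact ⟨u, (ConnectedComponent.exact hu).symm, hm⟩

theorem minLabel_le {G : LabelledGraph V} {u v : V} {h : ℕ} (huv : G.graph.Reachable v u)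
    (hh : h ∈ G.labels u) : G.minLabel (G.graph.connectedComponentMk v) ≤ h :=
  Nat.sInf_le ⟨u, ConnectedComponent.sound huv.symm, hh⟩

theorem contract_reachable {G : LabelledGraph V₁} {Q : LabelledGraph V₂} {b : B → V₁} {j : B → V₂}
    {β β' : B} (h : G.graph.Reachable (b β) (b β')) :
    ((G.contract b).map j ⊔ Q).graph.Reachable (j β) (j β') := by
  by_cases hj : j β = j β'
  · rw [hj]
  · have hne : β ≠ β' := fun e => hj (e ▸ rfl)
    exact SimpleGraph.Adj.reachable (Or.inl ⟨hj, β, β', ⟨hne, h⟩, rfl, rfl⟩)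

theorem not_reachable_of_mem_closedComponents {G : LabelledGraph V} {b : B → V} {x : V} {k : ℕ}
    (hx : G.graph.connectedComponentMk x ∈ G.closedComponents b k) (β : B) :
    ¬ G.graph.Reachable (b β) x :=
  fun h => hx.1 β (ConnectedComponent.sound h)

/-- The vertices of a graph with boundary `b` and of a graph with boundary `j` are glued along the
boundary, by the maps `ι` and `κ`. -/
structure IsGluing (ι : V₁ → W) (κ : V₂ → W) (b : B → V₁) (j : B → V₂) : Prop where
  inj_fst : Function.Injective ι
  inj_snd : Function.Injective κ
  comm : ∀ β, ι (b β) = κ (j β)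
  meet : ∀ x v, ι x = κ v → ∃ β, b β = x ∧ j β = v
  cover : ∀ w, (∃ x, ι x = w) ∨ ∃ v, κ v = w

namespace IsGluing

variable {ι : V₁ → W} {κ : V₂ → W} {b : B → V₁} {j : B → V₂} (s : IsGluing ι κ b j)
  {G : LabelledGraph V₁} {Q : LabelledGraph V₂}

include s

theorem reachable_of_fst {x y : V₁} (h : G.graph.Reachable x y) :
    (G.map ι ⊔ Q.map κ).graph.Reachable (ι x) (ι y) :=
  (h.map (Embedding.map ⟨ι, s.inj_fst⟩ G.graph).toHom).mono le_sup_left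

theorem reachable_of_contract {u v : V₂}
    (h : ((G.contract b).map j ⊔ Q).graph.Reachable u v) :
    (G.map ι ⊔ Q.map κ).graph.Reachable (κ u) (κ v) := by
  rw [reachable_iff_reflTransGen] at h
  induction h with
  | refl => rfl
  | tail _ h ih =>
    refine ih.trans ?_
    rcases h with ⟨-, β, β', e, rfl, rfl⟩ | e
    · rw [← s.comm, ← s.comm]
      exact s.reachable_of_fst e.2
    · exact SimpleGraph.Adj.reachable <| Or.inr <|
        (map_adj ⟨κ, s.inj_snd⟩ _ _ _).2 ⟨_, _, e, rfl, rfl⟩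

theorem reachable_from_snd {u : V₂} {w : W}
    (h : (G.map ι ⊔ Q.map κ).graph.Reachable (κ u) w) :
    (∀ v, κ v = w → ((G.contract b).map j ⊔ Q).graph.Reachable u v) ∧
      ∀ x, ι x = w → ∃ β, G.graph.Reachable (b β) x ∧
        ((G.contract b).map j ⊔ Q).graph.Reachable u (j β) := by
  rw [reachable_iff_reflTransGen] at h
  induction h with
  | refl =>
    refine ⟨fun v hv => s.inj_snd hv ▸ Reachable.refl _, fun x hx => ?_⟩
    obtain ⟨β, rfl, rfl⟩ := s.meet x u hx
    exact ⟨β, Reachable.refl _, Reachable.refl _⟩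
  | tail _ h ih =>
    rcases h with ⟨-, x, x', e, rfl, rfl⟩ | ⟨-, v, v', e, rfl, rfl⟩
    · obtain ⟨β, hβ, huβ⟩ := ih.2 x rfl
      have hβx' := hβ.trans e.reachable
      refine ⟨fun v hv => ?_, fun y hy => s.inj_fst hy ▸ ⟨β, hβx', huβ⟩⟩
      obtain ⟨β', rfl, rfl⟩ := s.meet x' v hv.symm
      exact huβ.trans (contract_reachable hβx')
    · have huv' := (ih.1 v rfl).trans (SimpleGraph.Adj.reachable (Or.inr e))
      refine ⟨fun y hy => s.inj_snd hy ▸ huv', fun x hx => ?_⟩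
      obtain ⟨β', rfl, rfl⟩ := s.meet x v' hx
      exact ⟨β', Reachable.refl _, huv'⟩

theorem reachable_from_closed {x : V₁} (hx : ∀ β, ¬ G.graph.Reachable (b β) x) {w : W}
    (h : (G.map ι ⊔ Q.map κ).graph.Reachable (ι x) w) :
    (∀ v, κ v ≠ w) ∧ ∃ y, ι y = w ∧ G.graph.Reachable x y := by
  have not_snd {y : V₁} (hxy : G.graph.Reachable x y) (v : V₂) : κ v ≠ ι y := fun hv => by
    obtain ⟨β, rfl, -⟩ := s.meet _ _ hv.symm
    exact hx β hxy.symm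
  rw [reachable_iff_reflTransGen] at h
  induction h with
  | refl => exact ⟨not_snd (Reachable.refl _), x, rfl, Reachable.refl _⟩
  | tail _ h ih =>
    obtain ⟨hw, y, rfl, hy⟩ := ih
    rcases h with ⟨-, z, z', e, hz, rfl⟩ | ⟨-, v, v', -, hv, rfl⟩
    · have hz' := hy.trans (s.inj_fst hz ▸ e.reachable)
      exact ⟨not_snd hz', z', rfl, hz'⟩
    · exact (hw v hv).elim

theorem reachable_iff {u v : V₂} : (G.map ι ⊔ Q.map κ).graph.Reachable (κ u) (κ v) ↔
    ((G.contract b).map j ⊔ Q).graph.Reachable u v :=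
  ⟨fun h => (s.reachable_from_snd h).1 v rfl, s.reachable_of_contract⟩

theorem minLabel_snd (hG : ∀ x, (G.labels x).Nonempty) (u : V₂) :
    (G.map ι ⊔ Q.map κ).minLabel (connectedComponentMk _ (κ u)) =
      ((G.contract b).map j ⊔ Q).minLabel (connectedComponentMk _ u) := by
  apply csInf_eq_csInf_of_forall_exists_le
  · rintro h ⟨w, hw, ⟨x, rfl, hx⟩ | ⟨v, rfl, hv⟩⟩
    · obtain ⟨β, hβx, huβ⟩ := (s.reachable_from_snd (ConnectedComponent.exact hw.symm)).2 x rfl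
      exact ⟨_, ⟨j β, ConnectedComponent.sound huβ.symm, Or.inl ⟨β, rfl, rfl⟩⟩, minLabel_le hβx hx⟩
    · exact ⟨h, ⟨v, ConnectedComponent.sound (s.reachable_iff.1 (ConnectedComponent.exact hw)),
        Or.inr hv⟩, le_rfl⟩
  · rintro h ⟨v, hv, ⟨β, rfl, rfl⟩ | hh⟩
    · obtain ⟨x, hx, hmem⟩ := exists_minLabel_mem hG (b β)
      have hxβ := s.reachable_of_fst (Q := Q) hx.symm
      rw [s.comm] at hxβ
      exact ⟨_, ⟨ι x, ConnectedComponent.sound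
        (hxβ.trans (s.reachable_of_contract (ConnectedComponent.exact hv))),
        Or.inl ⟨x, rfl, hmem⟩⟩, le_rfl⟩
    · exact ⟨h, ⟨κ v, ConnectedComponent.sound
        (s.reachable_of_contract (ConnectedComponent.exact hv)), Or.inr ⟨v, rfl, hh⟩⟩, le_rfl⟩

theorem minLabel_fst {x : V₁} (hx : ∀ β, ¬ G.graph.Reachable (b β) x) :
    (G.map ι ⊔ Q.map κ).minLabel (connectedComponentMk _ (ι x)) =
      G.minLabel (connectedComponentMk _ x) := by
  unfold minLabel
  congr 1
  ext h
  constructor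
  · rintro ⟨w, hw, hh⟩
    obtain ⟨hQ, y, rfl, hy⟩ := s.reachable_from_closed hx (ConnectedComponent.exact hw.symm)
    rcases hh with ⟨z, hz, hh⟩ | ⟨v, hv, -⟩
    · exact ⟨y, ConnectedComponent.sound hy.symm, s.inj_fst hz ▸ hh⟩
    · exact (hQ v hv).elim
  · rintro ⟨y, hy, hh⟩
    exact ⟨ι y, ConnectedComponent.sound (s.reachable_of_fst (ConnectedComponent.exact hy)),
      Or.inl ⟨y, rfl, hh⟩⟩

theorem contract_contract (hG : ∀ x, (G.labels x).Nonempty) (o : A → V₂) :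
    ((G.contract b).map j ⊔ Q).contract o = (G.map ι ⊔ Q.map κ).contract (κ ∘ o) := by
  apply LabelledGraph.ext
  · ext a a'
    exact and_congr_right fun _ => s.reachable_iff.symm
  · exact funext fun a => Set.singleton_eq_singleton_iff.2 (s.minLabel_snd hG (o a)).symm

/-- The component of the glued graph that contains a given component of the first graph. -/
def componentFst : G.graph.ConnectedComponent → (G.map ι ⊔ Q.map κ).graph.ConnectedComponent :=
  ConnectedComponent.lift (fun x => connectedComponentMk _ (ι x))
    fun _ _ p _ => ConnectedComponent.sound (s.reachable_of_fst p.reachable)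

/-- The component of the glued graph that contains a given component of the second graph, where the
first graph is contracted to the boundary. -/
noncomputable def componentSnd : ((G.contract b).map j ⊔ Q).graph.ConnectedComponent →
    (G.map ι ⊔ Q.map κ).graph.ConnectedComponent :=
  ConnectedComponent.lift (fun v => connectedComponentMk _ (κ v))
    fun _ _ p _ => ConnectedComponent.sound (s.reachable_of_contract p.reachable)

theorem componentSnd_injective :
    Function.Injective (s.componentSnd (G := G) (Q := Q)) := by
  intro γ δ
  induction γ, δ using ConnectedComponent.ind₂ with | _ u v
  exact fun h => ConnectedComponent.sound (s.reachable_iff.1 (ConnectedComponent.exact h))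

theorem componentFst_injOn (k : ℕ) :
    Set.InjOn (s.componentFst (Q := Q)) (G.closedComponents b k) := by
  intro γ hγ δ hδ
  induction γ, δ using ConnectedComponent.ind₂ with | _ x y
  intro h
  obtain ⟨-, z, hz, hxz⟩ := s.reachable_from_closed
    (not_reachable_of_mem_closedComponents hγ) (ConnectedComponent.exact h)
  exact ConnectedComponent.sound (s.inj_fst hz ▸ hxz)

theorem componentSnd_ne_componentFst {k : ℕ} {γ : G.graph.ConnectedComponent}
    (hγ : γ ∈ G.closedComponents b k) (δ : ((G.contract b).map j ⊔ Q).graph.ConnectedComponent) :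
    s.componentSnd δ ≠ s.componentFst γ := by
  induction γ using ConnectedComponent.ind with | _ x
  induction δ using ConnectedComponent.ind with | _ v
  intro h
  exact (s.reachable_from_closed (not_reachable_of_mem_closedComponents hγ)
    (ConnectedComponent.exact h.symm)).1 v rfl

theorem componentFst_mem_closedComponents {γ : G.graph.ConnectedComponent} {k : ℕ}
    (hγ : γ ∈ G.closedComponents b k) (o : A → V₂) :
    s.componentFst γ ∈ (G.map ι ⊔ Q.map κ).closedComponents (κ ∘ o) k := by
  refine ⟨fun a => s.componentSnd_ne_componentFst hγ (connectedComponentMk _ (o a)), ?_⟩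
  induction γ using ConnectedComponent.ind with | _ x
  exact (s.minLabel_fst (not_reachable_of_mem_closedComponents hγ)).trans hγ.2

theorem componentSnd_mem_closedComponents (hG : ∀ x, (G.labels x).Nonempty)
    {γ : ((G.contract b).map j ⊔ Q).graph.ConnectedComponent} {o : A → V₂} {k : ℕ} :
    s.componentSnd γ ∈ (G.map ι ⊔ Q.map κ).closedComponents (κ ∘ o) k ↔
      γ ∈ ((G.contract b).map j ⊔ Q).closedComponents o k := by
  have avoid (a : A) : connectedComponentMk _ ((κ ∘ o) a) ≠ s.componentSnd γ ↔
      connectedComponentMk _ (o a) ≠ γ :=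
    s.componentSnd_injective.ne_iff (x := connectedComponentMk _ (o a))
  have label : (G.map ι ⊔ Q.map κ).minLabel (s.componentSnd γ) =
      ((G.contract b).map j ⊔ Q).minLabel γ := by
    induction γ using ConnectedComponent.ind with | _ v
    exact s.minLabel_snd hG v
  simp only [closedComponents, Set.mem_ofPred_eq, avoid, label]

theorem mem_closedComponents_cases {γ : (G.map ι ⊔ Q.map κ).graph.ConnectedComponent}
    {o : A → V₂} {k : ℕ} (hγ : γ ∈ (G.map ι ⊔ Q.map κ).closedComponents (κ ∘ o) k) :
    (∃ δ ∈ G.closedComponents b k, s.componentFst δ = γ) ∨ ∃ δ, s.componentSnd δ = γ := by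
  induction γ using ConnectedComponent.ind with | _ w
  by_cases hw : ∃ v, (G.map ι ⊔ Q.map κ).graph.Reachable (κ v) w
  · obtain ⟨v, hv⟩ := hw
    exact Or.inr ⟨connectedComponentMk _ v, ConnectedComponent.sound hv⟩
  · push Not at hw
    rcases s.cover w with ⟨x, rfl⟩ | ⟨v, rfl⟩
    · have hx (β : B) : ¬ G.graph.Reachable (b β) x := fun hβ =>
        hw (j β) (s.comm β ▸ s.reachable_of_fst hβ)
      exact Or.inl ⟨connectedComponentMk _ x, ⟨fun β hβ => hx β (ConnectedComponent.exact hβ),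
        (s.minLabel_fst hx).symm.trans hγ.2⟩, rfl⟩
    · exact (hw v (Reachable.refl _)).elim

theorem ncard_closedComponents [Finite W] (hG : ∀ x, (G.labels x).Nonempty) (o : A → V₂) (k : ℕ) :
    ((G.map ι ⊔ Q.map κ).closedComponents (κ ∘ o) k).ncard =
      (G.closedComponents b k).ncard + (((G.contract b).map j ⊔ Q).closedComponents o k).ncard := by
  have union : (G.map ι ⊔ Q.map κ).closedComponents (κ ∘ o) k =
      s.componentFst '' G.closedComponents b k ∪
        s.componentSnd '' ((G.contract b).map j ⊔ Q).closedComponents o k := by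
    ext γ
    constructor
    · intro hγ
      rcases s.mem_closedComponents_cases hγ with h | ⟨δ, rfl⟩
      · exact Or.inl h
      · exact Or.inr ⟨δ, (s.componentSnd_mem_closedComponents hG).1 hγ, rfl⟩
    · rintro (⟨δ, hδ, rfl⟩ | ⟨δ, hδ, rfl⟩)
      · exact s.componentFst_mem_closedComponents hδ o
      · exact (s.componentSnd_mem_closedComponents hG).2 hδ
  rw [union, Set.ncard_union_eq _ (Set.toFinite _) (Set.toFinite _),
    (s.componentFst_injOn k).ncard_image, Set.ncard_image_of_injective _ s.componentSnd_injective]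
  rw [Set.disjoint_left]
  rintro _ ⟨γ, hγ, rfl⟩ ⟨δ, -, h⟩
  exact s.componentSnd_ne_componentFst hγ δ h

end IsGluing

end LabelledGraph

namespace LabelledArcs

open SimpleGraph

variable {N : ℕ}

/-- The labelled arcs as a labelled graph, where a node carries the label of the arc that ends in
it. -/
def toLabelledGraph (D : LabelledArcs N) : LabelledGraph (ArcNode N) where
  graph := D.graph
  labels a := {D.height a}

/-- The graph `glue C D`, whose vertices carry the labels of the arc fragments that end in them. -/
def glued (C D : LabelledArcs N) : LabelledGraph (Fin 3 × Fin N) :=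
  C.toLabelledGraph.map nodeFst ⊔ D.toLabelledGraph.map nodeSnd

theorem toLabelledGraph_injective :
    Function.Injective (toLabelledGraph : LabelledArcs N → LabelledGraph (ArcNode N)) := by
  intro C D h
  ext1
  · exact congrArg LabelledGraph.graph h
  · exact funext fun a => Set.singleton_injective (congrFun (congrArg LabelledGraph.labels h) a)

theorem nodeFst_injective : Function.Injective (nodeFst (N := N)) := by
  rintro (a | a) (b | b) <;> simp [nodeFst]

theorem nodeSnd_injective : Function.Injective (nodeSnd (N := N)) := by
  rintro (a | a) (b | b) <;> simp [nodeSnd]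

theorem glued_labels_nonempty (C D : LabelledArcs N) (w : Fin 3 × Fin N) :
    ((glued C D).labels w).Nonempty := by
  obtain ⟨c, i⟩ := w
  fin_cases c
  · exact ⟨_, Or.inl ⟨Sum.inl i, rfl, rfl⟩⟩
  · exact ⟨_, Or.inl ⟨Sum.inr i, rfl, rfl⟩⟩
  · exact ⟨_, Or.inr ⟨Sum.inr i, rfl, rfl⟩⟩

theorem compHeight_eq_minLabel (C D : LabelledArcs N) (γ : (glue C D).ConnectedComponent) :
    compHeight C D γ = (glued C D).minLabel γ := by
  unfold compHeight LabelledGraph.minLabel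
  congr 1
  ext h
  constructor
  · rintro (⟨a, h1, h2⟩ | ⟨a, h1, h2⟩)
    exacts [⟨_, h1, Or.inl ⟨a, rfl, h2.symm⟩⟩, ⟨_, h1, Or.inr ⟨a, rfl, h2.symm⟩⟩]
  · rintro ⟨_, h1, ⟨a, rfl, h2⟩ | ⟨a, rfl, h2⟩⟩
    exacts [Or.inl ⟨a, h1, h2.symm⟩, Or.inr ⟨a, h1, h2.symm⟩]

theorem toLabelledGraph_comp (C D : LabelledArcs N) :
    (comp C D).toLabelledGraph = (glued C D).contract nodeOuter :=
  LabelledGraph.ext rfl <| funext fun _ =>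
    Set.singleton_eq_singleton_iff.2 (compHeight_eq_minLabel C D _)

theorem loops_eq_ncard_closedComponents (C D : LabelledArcs N) (k : ℕ) :
    loops C D k = ((glued C D).closedComponents nodeOuter k).ncard := by
  simp only [loops, compHeight_eq_minLabel]
  rfl

/-- The embedding of the nodes of a composition of two diagrams into those of a composition of
three that is given by the choice of three of the four columns. -/
def columns (f : Fin 3 → Fin 4) (w : Fin 3 × Fin N) : Fin 4 × Fin N := (f w.1, w.2)

theorem columns_injective {f : Fin 3 → Fin 4} (hf : Function.Injective f) :
    Function.Injective (columns (N := N) f) :=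
  hf.prodMap Function.injective_id

theorem isGluing_left : LabelledGraph.IsGluing (columns (N := N) ![0, 1, 2]) (columns ![0, 2, 3])
    nodeOuter nodeFst where
  inj_fst := columns_injective (by decide)
  inj_snd := columns_injective (by decide)
  comm := by rintro (i | i) <;> rfl
  meet := by
    rintro ⟨c, i⟩ ⟨d, j⟩ h
    simp only [columns, Prod.mk.injEq] at h
    obtain ⟨h, rfl⟩ := h
    fin_cases c <;> fin_cases d <;> simp at h
    exacts [⟨Sum.inl i, rfl, rfl⟩, ⟨Sum.inr i, rfl, rfl⟩]
  cover := by
    rintro ⟨c, i⟩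
    fin_cases c
    exacts [Or.inl ⟨(0, i), rfl⟩, Or.inl ⟨(1, i), rfl⟩, Or.inl ⟨(2, i), rfl⟩, Or.inr ⟨(2, i), rfl⟩]

theorem isGluing_right : LabelledGraph.IsGluing (columns (N := N) ![1, 2, 3]) (columns ![0, 1, 3])
    nodeOuter nodeSnd where
  inj_fst := columns_injective (by decide)
  inj_snd := columns_injective (by decide)
  comm := by rintro (i | i) <;> rfl
  meet := by
    rintro ⟨c, i⟩ ⟨d, j⟩ h
    simp only [columns, Prod.mk.injEq] at h
    obtain ⟨h, rfl⟩ := h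
    fin_cases c <;> fin_cases d <;> simp at h
    exacts [⟨Sum.inl i, rfl, rfl⟩, ⟨Sum.inr i, rfl, rfl⟩]
  cover := by
    rintro ⟨c, i⟩
    fin_cases c
    exacts [Or.inr ⟨(0, i), rfl⟩, Or.inl ⟨(0, i), rfl⟩, Or.inl ⟨(1, i), rfl⟩, Or.inl ⟨(2, i), rfl⟩]

theorem glued_comp_left (C D E : LabelledArcs N) : glued (comp C D) E =
    ((glued C D).contract nodeOuter).map nodeFst ⊔ E.toLabelledGraph.map nodeSnd := by
  rw [glued, toLabelledGraph_comp]

theorem glued_comp_right (C D E : LabelledArcs N) : glued C (comp D E) =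
    ((glued D E).contract nodeOuter).map nodeSnd ⊔ C.toLabelledGraph.map nodeFst := by
  rw [glued, toLabelledGraph_comp, LabelledGraph.sup_comm]

theorem glued_triple (C D E : LabelledArcs N) :
    (glued C D).map (columns ![0, 1, 2]) ⊔
        (E.toLabelledGraph.map nodeSnd).map (columns ![0, 2, 3]) =
      (glued D E).map (columns ![1, 2, 3]) ⊔
        (C.toLabelledGraph.map nodeFst).map (columns ![0, 1, 3]) := by
  have outer : columns (N := N) ![0, 1, 2] ∘ nodeFst = columns ![0, 1, 3] ∘ nodeFst := by
    ext1 (i | i) <;> rfl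
  have middle : columns (N := N) ![0, 1, 2] ∘ nodeSnd = columns ![1, 2, 3] ∘ nodeFst := by
    ext1 (i | i) <;> rfl
  have last : columns (N := N) ![0, 2, 3] ∘ nodeSnd = columns ![1, 2, 3] ∘ nodeSnd := by
    ext1 (i | i) <;> rfl
  simp only [glued, LabelledGraph.map_sup, LabelledGraph.map_map, outer, middle, last]
  rw [LabelledGraph.sup_assoc, LabelledGraph.sup_comm]

theorem columns_comp_nodeOuter :
    columns (N := N) ![0, 2, 3] ∘ nodeOuter = columns ![0, 1, 3] ∘ nodeOuter := by
  ext1 (i | i) <;> rfl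

theorem comp_assoc (C D E : LabelledArcs N) : comp (comp C D) E = comp C (comp D E) := by
  apply toLabelledGraph_injective
  rw [toLabelledGraph_comp, toLabelledGraph_comp, glued_comp_left, glued_comp_right,
    isGluing_left.contract_contract (glued_labels_nonempty C D),
    isGluing_right.contract_contract (glued_labels_nonempty D E), glued_triple,
    columns_comp_nodeOuter]

theorem loops_cocycle (C D E : LabelledArcs N) (k : ℕ) :
    loops C D k + loops (comp C D) E k = loops D E k + loops C (comp D E) k := by
  rw [loops_eq_ncard_closedComponents C D, loops_eq_ncard_closedComponents D E,
    loops_eq_ncard_closedComponents, loops_eq_ncard_closedComponents, glued_comp_left,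
    glued_comp_right, ← isGluing_left.ncard_closedComponents (glued_labels_nonempty C D),
    ← isGluing_right.ncard_closedComponents (glued_labels_nonempty D E), glued_triple,
    columns_comp_nodeOuter]

/-- The integer of which `yExp` is the truncation. -/
noncomputable def yExpInt (C D : LabelledArcs N) (i : ℕ) : ℤ :=
  ∑ j ∈ Finset.Ico (i + 1) N, (-1 : ℤ) ^ (j - (i + 1)) *
    ((boxes C j : ℤ) + boxes D j - boxes (comp C D) j - loops C D j)

theorem yExpInt_cocycle (C D E : LabelledArcs N) (i : ℕ) :
    yExpInt C D i + yExpInt (comp C D) E i = yExpInt D E i + yExpInt C (comp D E) i := by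
  unfold yExpInt
  rw [← Finset.sum_add_distrib, ← Finset.sum_add_distrib, comp_assoc]
  refine Finset.sum_congr rfl fun j _ => ?_
  have h : (loops C D j : ℤ) + loops (comp C D) E j = loops D E j + loops C (comp D E) j := by
    exact_mod_cast loops_cocycle C D E j
  linear_combination (-1 : ℤ) * (-1 : ℤ) ^ (j - (i + 1)) * h

end LabelledArcs

namespace LabelledGraph

open SimpleGraph

variable {A V : Type*} {G : LabelledGraph V} {o : A → V} {τ : A → A} {ψ : V → Option A}

theorem minLabel_eq {v : V} {n : ℕ}
    (le : ∀ w, G.graph.Reachable v w → ∀ h ∈ G.labels w, n ≤ h)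
    (mem : ∃ w, G.graph.Reachable v w ∧ n ∈ G.labels w) :
    G.minLabel (G.graph.connectedComponentMk v) = n := by
  obtain ⟨w, hw, hn⟩ := mem
  refine le_antisymm (minLabel_le hw hn) (le_csInf ⟨n, w, ConnectedComponent.sound hw.symm, hn⟩ ?_)
  rintro h ⟨u, hu, hh⟩
  exact le u (ConnectedComponent.exact hu.symm) h hh

/-- The components of `G` are determined by a map `ψ` that sends a vertex to a boundary vertex in
its component, or to `none` if there is none; `τ` gives the other boundary vertex in the component
of a boundary vertex. -/
structure IsResolution (G : LabelledGraph V) (o : A → V) (τ : A → A) (ψ : V → Option A) :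
    Prop where
  involutive : Function.Involutive τ
  boundary : ∀ a, ψ (o a) = some a
  adj : ∀ v w, G.graph.Adj v w → ψ v = ψ w ∨ ψ v = (ψ w).map τ
  reachable : ∀ v a, ψ v = some a → G.graph.Reachable v (o a)
  reachable_partner : ∀ a, G.graph.Reachable (o a) (o (τ a))

namespace IsResolution

theorem eq_or_eq_map (r : G.IsResolution o τ ψ) {v w : V} (h : G.graph.Reachable v w) :
    ψ v = ψ w ∨ ψ v = (ψ w).map τ := by
  rw [reachable_iff_reflTransGen] at h
  induction h with
  | refl => exact Or.inl rfl
  | @tail u w _ h ih =>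
    have hττ (x : Option A) : (x.map τ).map τ = x := by
      rw [Option.map_map, r.involutive.comp_self, Option.map_id, id]
    rcases ih with ih | ih <;> rcases r.adj _ _ h with e | e <;> simp [ih, e, hττ]

theorem reachable_iff (r : G.IsResolution o τ ψ) {a b : A} :
    G.graph.Reachable (o a) (o b) ↔ a = b ∨ τ a = b := by
  constructor
  · intro h
    have := r.eq_or_eq_map h
    simp only [r.boundary, Option.map_some, Option.some.injEq] at this
    exact this.imp_right fun e => by rw [e, r.involutive]
  · rintro (rfl | rfl)
    · rfl
    · exact r.reachable_partner a

theorem contract_eq (r : G.IsResolution o τ ψ) {h : A → ℕ} (h_partner : ∀ a, h (τ a) = h a)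
    (le : ∀ v a, ψ v = some a → ∀ n ∈ G.labels v, h a ≤ n)
    (mem : ∀ a, ∃ v, G.graph.Reachable (o a) v ∧ h a ∈ G.labels v) :
    G.contract o = ⟨SimpleGraph.fromRel (τ · = ·), fun a => {h a}⟩ := by
  apply LabelledGraph.ext
  · ext a b
    change a ≠ b ∧ G.graph.Reachable (o a) (o b) ↔ a ≠ b ∧ (τ a = b ∨ τ b = a)
    rw [r.reachable_iff]
    have := r.involutive
    grind [Function.Involutive]
  · refine funext fun a => Set.singleton_eq_singleton_iff.2 <|
      minLabel_eq (fun v hv n hn => ?_) (mem a)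
    rcases r.eq_or_eq_map hv.symm with e | e
    · exact le v a (e.trans (r.boundary a)) n hn
    · rw [← h_partner a]
      exact le v (τ a) (by rw [e, r.boundary, Option.map_some]) n hn

theorem closedComponents_eq_empty (r : G.IsResolution o τ ψ) (hψ : ∀ v, ψ v ≠ none) (k : ℕ) :
    G.closedComponents o k = ∅ := by
  refine Set.eq_empty_of_forall_notMem fun γ hγ => ?_
  induction γ using ConnectedComponent.ind with | _ v
  obtain ⟨a, ha⟩ := Option.ne_none_iff_exists'.1 (hψ v)
  exact hγ.1 a (ConnectedComponent.sound (r.reachable v a ha).symm)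

theorem not_reachable_of_eq_none (r : G.IsResolution o τ ψ) {v : V} (hv : ψ v = none) (a : A) :
    ¬ G.graph.Reachable (o a) v := fun h => by
  simpa [hv, r.boundary] using r.eq_or_eq_map h

theorem ncard_closedComponents_of_unique (r : G.IsResolution o τ ψ) {v : V} (hv : ψ v = none)
    (unique : ∀ w, ψ w = none → G.graph.Reachable v w) (k : ℕ) :
    (G.closedComponents o k).ncard =
      if k = G.minLabel (G.graph.connectedComponentMk v) then 1 else 0 := by
  have closed_eq {γ : G.graph.ConnectedComponent}
      (hγ : ∀ a, G.graph.connectedComponentMk (o a) ≠ γ) : γ = G.graph.connectedComponentMk v := by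
    induction γ using ConnectedComponent.ind with | _ w
    refine ConnectedComponent.sound (unique w ?_).symm
    by_contra hw
    obtain ⟨a, ha⟩ := Option.ne_none_iff_exists'.1 hw
    exact hγ a (ConnectedComponent.sound (r.reachable w a ha).symm)
  split_ifs with hk
  · rw [Set.ncard_eq_one]
    refine ⟨_, Set.eq_singleton_iff_unique_mem.2 ⟨⟨fun a ha => ?_, hk.symm⟩,
      fun γ hγ => closed_eq hγ.1⟩⟩
    exact r.not_reachable_of_eq_none hv a (ConnectedComponent.exact ha)
  · rw [Set.ncard_eq_zero (Set.Finite.subset (Set.finite_singleton _) fun γ hγ => closed_eq hγ.1)]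
    refine Set.eq_empty_of_forall_notMem fun γ hγ => hk ?_
    rw [← closed_eq hγ.1, hγ.2]

end IsResolution

end LabelledGraph

/-! ### Arc-diagrams as pairings -/

/-- The labelled arcs that join each node `a` to `σ a`. -/
def LabelledArcs.ofPairing {N : ℕ} (σ : ArcNode N → ArcNode N) (h : ArcNode N → ℕ) :
    LabelledArcs N where
  graph := SimpleGraph.fromRel (σ · = ·)
  height := h

/-- The conditions on a pairing `σ` of the nodes with labels `h` to be an Okada arc-diagram, stated
in terms of the positions of the nodes alone: the label of an arc has the parity of the position of
its last end. -/
structure IsOkadaPairing {N : ℕ} (σ : ArcNode N → ArcNode N) (h : ArcNode N → ℕ) : Prop where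
  involutive : Function.Involutive σ
  ne : ∀ a, σ a ≠ a
  height_partner : ∀ a, h (σ a) = h a
  one_le : ∀ a, 1 ≤ h a
  le_level : ∀ a, h a ≤ a.level
  inside : ∀ a b, a.pos < b.pos → b.pos < (σ a).pos →
    a.pos < (σ b).pos ∧ (σ b).pos < (σ a).pos ∧ h a < h b
  parity : ∀ a, a.pos < (σ a).pos → h a % 2 = (σ a).pos % 2 ∧ a.pos % 2 ≠ (σ a).pos % 2

theorem ArcNode.exists_pos_eq {N n : ℕ} (hn : n < 2 * N) : ∃ a : ArcNode N, a.pos = n := by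
  by_cases h : n < N
  · exact ⟨Sum.inl ⟨n, h⟩, rfl⟩
  · refine ⟨Sum.inr ⟨2 * N - 1 - n, by omega⟩, ?_⟩
    simp only [ArcNode.pos]
    omega

theorem ArcNode.pos_lt {N : ℕ} (a : ArcNode N) : a.pos < 2 * N := by
  have := OkadaDiagram.pos_level a
  omega

theorem ArcNode.pos_eq_pos_iff {N : ℕ} {a b : ArcNode N} : a.pos = b.pos ↔ a = b :=
  ⟨OkadaDiagram.pos_injective, fun h => h ▸ rfl⟩

theorem even_card_of_involutive {α : Type*} {s : Finset α} {σ : α → α}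
    (involutive : Function.Involutive σ) (ne : ∀ a ∈ s, σ a ≠ a) (mem : ∀ a ∈ s, σ a ∈ s) :
    Even s.card := by
  rw [← CharP.cast_eq_zero_iff (ZMod 2) 2 _ |>.trans even_iff_two_dvd.symm, Finset.cast_card]
  exact Finset.sum_involution (fun a _ => σ a) (fun _ _ => by decide) (fun a ha _ => ne a ha) mem
    fun a _ => involutive a

namespace LabelledArcs

variable {N : ℕ} {σ : ArcNode N → ArcNode N} {D : LabelledArcs N}

namespace IsOkada

theorem involutive_of_partner (hD : D.IsOkada) (hσ : ∀ a, D.graph.Adj a (σ a)) :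
    Function.Involutive σ := fun a =>
  (hD.matching (σ a)).unique (hσ (σ a)) (hσ a).symm

theorem pos_partner_of_inside (hD : D.IsOkada) (hσ : ∀ a, D.graph.Adj a (σ a)) {a b : ArcNode N}
    (hab : a.pos < b.pos) (hba : b.pos < (σ a).pos) :
    a.pos < (σ b).pos ∧ (σ b).pos < (σ a).pos := by
  have hσσ := hD.involutive_of_partner hσ
  have first_ne : (σ b).pos ≠ a.pos := fun h => by
    rw [ArcNode.pos_eq_pos_iff] at h
    rw [← h, hσσ] at hba
    omega
  have last_ne : (σ b).pos ≠ (σ a).pos := fun h => by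
    rw [ArcNode.pos_eq_pos_iff, hσσ.injective.eq_iff] at h
    exact hab.ne' (h ▸ rfl)
  have := hD.noncrossing a b (σ a) (σ b) (hσ a) (hσ b)
  have := hD.noncrossing (σ b) a b (σ a) (hσ b).symm (hσ a)
  omega

theorem height_lt_of_inside (hD : D.IsOkada) (hσ : ∀ a, D.graph.Adj a (σ a)) {a b : ArcNode N}
    (hab : a.pos < b.pos) (hba : b.pos < (σ a).pos) : D.height a < D.height b := by
  obtain ⟨hab', hba'⟩ := hD.pos_partner_of_inside hσ hab hba
  rcases lt_or_ge b.pos (σ b).pos with h | h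
  · exact hD.nested b (σ b) a (σ a) (hσ b) (hσ a) hab h hba'
  · have hne : b.pos ≠ (σ b).pos := fun h => (hσ b).ne (ArcNode.pos_eq_pos_iff.1 h)
    rw [hD.height_eq b (σ b) (hσ b)]
    exact hD.nested (σ b) b a (σ a) (hσ b).symm (hσ a) hab' (by omega) hba

/-- The nodes inside an arc are matched among themselves, so there is an even number of them. -/
theorem pos_parity (hD : D.IsOkada) (hσ : ∀ a, D.graph.Adj a (σ a)) {a : ArcNode N}
    (ha : a.pos < (σ a).pos) : a.pos % 2 ≠ (σ a).pos % 2 := by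
  let inside := Finset.univ.filter fun b : ArcNode N => a.pos < b.pos ∧ b.pos < (σ a).pos
  have card_inside : inside.card = (σ a).pos - a.pos - 1 := by
    rw [← Nat.card_Ioo, ← Finset.card_image_of_injective _ fun _ _ => OkadaDiagram.pos_injective]
    congr 1
    ext n
    simp only [inside, Finset.mem_image, Finset.mem_filter, Finset.mem_univ, true_and,
      Finset.mem_Ioo]
    constructor
    · rintro ⟨b, hb, rfl⟩
      exact hb
    · intro hn
      obtain ⟨b, rfl⟩ := ArcNode.exists_pos_eq (hn.2.trans (σ a).pos_lt)
      exact ⟨b, hn, rfl⟩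
  have even_card : Even inside.card := by
    refine even_card_of_involutive (hD.involutive_of_partner hσ) (fun b _ => (hσ b).ne') ?_
    intro b hb
    simp only [inside, Finset.mem_filter, Finset.mem_univ, true_and] at hb ⊢
    exact hD.pos_partner_of_inside hσ hb.1 hb.2
  rw [card_inside, Nat.even_iff] at even_card
  omega

theorem isOkadaPairing (hD : D.IsOkada) (hσ : ∀ a, D.graph.Adj a (σ a)) :
    IsOkadaPairing σ D.height where
  involutive := hD.involutive_of_partner hσ
  ne a := (hσ a).ne'
  height_partner a := (hD.height_eq _ _ (hσ a)).symm
  one_le := hD.one_le_height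
  le_level a := (hD.height_le _ _ (hσ a)).trans (min_le_left _ _)
  inside a b hab hba :=
    ⟨(hD.pos_partner_of_inside hσ hab hba).1, (hD.pos_partner_of_inside hσ hab hba).2,
      hD.height_lt_of_inside hσ hab hba⟩
  parity a ha := by
    have hpos := hD.pos_parity hσ ha
    have hmod : D.height a % 2 = min a.level (σ a).level % 2 := hD.parity _ _ (hσ a)
    have := OkadaDiagram.pos_level a
    have := OkadaDiagram.pos_level (σ a)
    omega

end IsOkada

end LabelledArcs

namespace IsOkadaPairing

open LabelledArcs

variable {N : ℕ} {σ : ArcNode N → ArcNode N} {h : ArcNode N → ℕ}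

theorem adj_iff (l : IsOkadaPairing σ h) {a b : ArcNode N} :
    (ofPairing σ h).graph.Adj a b ↔ σ a = b := by
  have := l.involutive
  have := l.ne
  simp only [ofPairing, SimpleGraph.fromRel_adj]
  grind [Function.Involutive]

theorem isOkada (l : IsOkadaPairing σ h) : (ofPairing σ h).IsOkada where
  matching a := ⟨σ a, l.adj_iff.2 rfl, fun b hb => (l.adj_iff.1 hb).symm⟩
  noncrossing a b c d hac hbd := by
    obtain ⟨rfl, rfl⟩ := And.intro (l.adj_iff.1 hac) (l.adj_iff.1 hbd)
    have := l.inside a b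
    omega
  height_eq a b hab := l.adj_iff.1 hab ▸ (l.height_partner a).symm
  one_le_height := l.one_le
  height_le a b hab := by
    obtain rfl := l.adj_iff.1 hab
    exact le_min (l.le_level a) ((l.height_partner a).symm.trans_le (l.le_level (σ a)))
  parity a b hab := by
    obtain rfl := l.adj_iff.1 hab
    have hne : a.pos ≠ (σ a).pos := fun e => l.ne a (ArcNode.pos_eq_pos_iff.1 e).symm
    have ha := l.parity a
    have hσa := l.parity (σ a)
    rw [l.involutive, l.height_partner] at hσa
    have := OkadaDiagram.pos_level a
    have := OkadaDiagram.pos_level (σ a)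
    change h a % 2 = min a.level (σ a).level % 2
    omega
  nested a b c d hab hcd hca _ hbd := by
    obtain ⟨rfl, rfl⟩ := And.intro (l.adj_iff.1 hab) (l.adj_iff.1 hcd)
    exact (l.inside c a hca (by omega)).2.2

end IsOkadaPairing

theorem LabelledArcs.IsOkada.exists_eq_ofPairing {N : ℕ} {D : LabelledArcs N} (hD : D.IsOkada) :
    ∃ σ, IsOkadaPairing σ D.height ∧ D = LabelledArcs.ofPairing σ D.height := by
  choose σ hσ using fun a => (hD.matching a).exists
  refine ⟨σ, hD.isOkadaPairing hσ, LabelledArcs.ext ?_ rfl⟩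
  ext a b
  have hab : D.graph.Adj a b ↔ σ a = b :=
    ⟨fun h => (hD.matching a).unique (hσ a) h, fun h => h ▸ hσ a⟩
  rw [hab, (hD.isOkadaPairing hσ).adj_iff]

theorem LabelledArcs.IsOkada.eq_ofPairing {N : ℕ} {D : LabelledArcs N} (hD : D.IsOkada)
    {σ : ArcNode N → ArcNode N} (hσ : ∀ a b, D.graph.Adj a b → σ a = b) :
    IsOkadaPairing σ D.height ∧ D = LabelledArcs.ofPairing σ D.height := by
  obtain ⟨τ, l, hDτ⟩ := hD.exists_eq_ofPairing
  have hτσ : τ = σ := funext fun a => (hσ a (τ a) (by rw [hDτ]; exact l.adj_iff.2 rfl)).symm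
  exact hτσ ▸ ⟨l, hDτ⟩

namespace LabelledArcs

variable {N : ℕ} {σ : ArcNode N → ArcNode N} {h : ArcNode N → ℕ}

theorem glue_adj {C D : LabelledArcs N} {w w' : Fin 3 × Fin N} : (glue C D).Adj w w' ↔
    (∃ a b, C.graph.Adj a b ∧ nodeFst a = w ∧ nodeFst b = w') ∨
      ∃ a b, D.graph.Adj a b ∧ nodeSnd a = w ∧ nodeSnd b = w' :=
  or_congr (SimpleGraph.map_adj ⟨nodeFst, nodeFst_injective⟩ C.graph w w')
    (SimpleGraph.map_adj ⟨nodeSnd, nodeSnd_injective⟩ D.graph w w')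

theorem glue_adj_fst {C D : LabelledArcs N} {a b : ArcNode N} (hab : C.graph.Adj a b) :
    (glue C D).Adj (nodeFst a) (nodeFst b) :=
  glue_adj.2 (Or.inl ⟨a, b, hab, rfl, rfl⟩)

theorem glue_adj_snd {C : LabelledArcs N} (l : IsOkadaPairing σ h) (a : ArcNode N) :
    (glue C (ofPairing σ h)).Adj (nodeSnd a) (nodeSnd (σ a)) :=
  glue_adj.2 (Or.inr ⟨a, σ a, l.adj_iff.2 rfl, rfl, rfl⟩)

theorem comp_eq_ofPairing {C D : LabelledArcs N} {ψ : Fin 3 × Fin N → Option (ArcNode N)}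
    (r : (glued C D).IsResolution nodeOuter σ ψ) (h_partner : ∀ a, h (σ a) = h a)
    (le_fst : ∀ x a, ψ (nodeFst x) = some a → h a ≤ C.height x)
    (le_snd : ∀ x a, ψ (nodeSnd x) = some a → h a ≤ D.height x)
    (mem : ∀ a, ∃ v, (glue C D).Reachable (nodeOuter a) v ∧ h a ∈ (glued C D).labels v) :
    comp C D = ofPairing σ h := by
  apply toLabelledGraph_injective
  rw [toLabelledGraph_comp]
  refine r.contract_eq h_partner ?_ mem
  rintro _ a ha n (⟨x, rfl, rfl⟩ | ⟨x, rfl, rfl⟩)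
  · exact le_fst x a ha
  · exact le_snd x a ha

/-- The node of the second diagram that is reached from a node of `C ∘ D` along a horizontal strand
of the first. -/
def foldLeft (w : Fin 3 × Fin N) : ArcNode N :=
  if w.1 = 2 then Sum.inr w.2 else Sum.inl w.2

theorem foldLeft_nodeOuter (a : ArcNode N) : foldLeft (nodeOuter a) = a := by
  rcases a with a | a <;> rfl

theorem foldLeft_nodeSnd (a : ArcNode N) : foldLeft (nodeSnd a) = a := by
  rcases a with a | a <;> rfl

theorem level_foldLeft_nodeFst (a : ArcNode N) : (foldLeft (nodeFst a)).level = a.level := by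
  rcases a with a | a <;> rfl

theorem id_adj {a b : ArcNode N} (hab : (OkadaDiagram.id N).val.graph.Adj a b) :
    foldLeft (nodeFst a) = foldLeft (nodeFst b) := by
  obtain ⟨-, ⟨j, rfl, rfl⟩ | ⟨j, rfl, rfl⟩⟩ := hab <;> rfl

theorem glue_id_reachable (D : LabelledArcs N) (w : Fin 3 × Fin N) :
    (glue (OkadaDiagram.id N).val D).Reachable w (nodeOuter (foldLeft w)) := by
  obtain ⟨c, j⟩ := w
  fin_cases c
  · rfl
  · have hj : (OkadaDiagram.id N).val.graph.Adj (Sum.inr j) (Sum.inl j) :=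
      ⟨by simp, Or.inr ⟨j, rfl, rfl⟩⟩
    exact (glue_adj_fst hj).reachable
  · rfl

theorem isResolution_id (l : IsOkadaPairing σ h) :
    (glued (OkadaDiagram.id N).val (ofPairing σ h)).IsResolution nodeOuter σ (some ∘ foldLeft) where
  involutive := l.involutive
  boundary a := congrArg some (foldLeft_nodeOuter a)
  adj v w hvw := by
    rcases glue_adj.1 hvw with ⟨a, b, hab, rfl, rfl⟩ | ⟨a, b, hab, rfl, rfl⟩
    · exact Or.inl (congrArg some (id_adj hab))
    · obtain rfl := l.adj_iff.1 hab
      simp [foldLeft_nodeSnd, l.involutive a]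
  reachable v a hva := Option.some_injective _ hva ▸ glue_id_reachable _ v
  reachable_partner a := by
    have ha := glue_id_reachable (ofPairing σ h) (nodeSnd a)
    have hσa := glue_id_reachable (ofPairing σ h) (nodeSnd (σ a))
    rw [foldLeft_nodeSnd] at ha hσa
    exact ha.symm.trans ((glue_adj_snd l a).reachable.trans hσa)

end LabelledArcs

namespace OkadaDiagram

open LabelledArcs

variable {N : ℕ}

theorem id_comp (D : OkadaDiagram N) : comp (id N).val D.val = D.val := by
  obtain ⟨σ, l, hD⟩ := D.property.exists_eq_ofPairing
  rw [hD]
  have r := isResolution_id l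
  refine comp_eq_ofPairing r l.height_partner (fun x a hxa => ?_) (fun x a hxa => ?_) fun a => ?_
  · obtain rfl := Option.some_injective _ hxa
    exact (l.le_level _).trans_eq (level_foldLeft_nodeFst x)
  · obtain rfl := Option.some_injective _ hxa
    rw [foldLeft_nodeSnd]
    rfl
  · exact ⟨nodeSnd a, (r.reachable _ a (congrArg some (foldLeft_nodeSnd a))).symm,
      Or.inr ⟨a, rfl, rfl⟩⟩

theorem loops_id (D : OkadaDiagram N) (k : ℕ) : loops (id N).val D.val k = 0 := by
  obtain ⟨σ, l, hD⟩ := D.property.exists_eq_ofPairing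
  rw [hD, loops_eq_ncard_closedComponents,
    (isResolution_id l).closedComponents_eq_empty (fun _ => Option.some_ne_none _), Set.ncard_empty]

theorem boxes_id (j : ℕ) : boxes (id N).val j = 0 := by
  have empty : {a : ArcNode N | (id N).val.height a ≤ j ∧ j < a.level} = ∅ :=
    Set.eq_empty_of_forall_notMem fun a ha => (ha.1.trans_lt ha.2).false
  rw [boxes, empty, Set.ncard_empty]

theorem yExpInt_id (D : OkadaDiagram N) (i : ℕ) : yExpInt (id N).val D.val i = 0 := by
  simp [yExpInt, boxes_id, loops_id, id_comp]

end OkadaDiagram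

/-! ### Composition with an elementary diagram -/

namespace ArcNode

variable {N : ℕ}

/-- The node `i` on the left boundary, in the paper's indexing of the generators. -/
def lower (i : Fin (N - 1)) : ArcNode N := Sum.inl ⟨i.val, by omega⟩

/-- The node `i + 1` on the left boundary, in the paper's indexing of the generators. -/
def upper (i : Fin (N - 1)) : ArcNode N := Sum.inl ⟨i.val + 1, by omega⟩

theorem pos_lower (i : Fin (N - 1)) : (lower i).pos = i.val := rfl

theorem pos_upper (i : Fin (N - 1)) : (upper i).pos = i.val + 1 := rfl

theorem level_lower (i : Fin (N - 1)) : (lower i).level = i.val + 1 := rfl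

theorem level_upper (i : Fin (N - 1)) : (upper i).level = i.val + 2 := rfl

theorem lower_ne_upper (i : Fin (N - 1)) : lower i ≠ upper i := by
  simp [lower, upper]

end ArcNode

namespace LabelledArcs

open ArcNode

variable {N : ℕ} {σ : ArcNode N → ArcNode N} {h : ArcNode N → ℕ} {i : Fin (N - 1)}

/-- The pairing of `[g_i ∘ D]` in terms of the pairing `σ` of `D`: the nodes `i` and `i + 1` are
paired, and so are the nodes that they were paired with. -/
def cap (i : Fin (N - 1)) (σ : ArcNode N → ArcNode N) (a : ArcNode N) : ArcNode N :=
  if a = lower i then upper i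
  else if a = upper i then lower i
  else if σ a = lower i then σ (upper i)
  else if σ a = upper i then σ (lower i)
  else σ a

/-- The labels of `[g_i ∘ D]` in terms of the pairing and the labels of `D`. -/
def capHeight (i : Fin (N - 1)) (σ : ArcNode N → ArcNode N) (h : ArcNode N → ℕ) (a : ArcNode N) :
    ℕ :=
  if a = lower i ∨ a = upper i then i.val + 1
  else if σ a = lower i ∨ σ a = upper i then min (h (lower i)) (h (upper i))
  else h a

theorem cap_involutive (l : IsOkadaPairing σ h) : Function.Involutive (cap i σ) := fun a => by
  have := l.involutive
  have := l.ne
  have := lower_ne_upper i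
  grind [cap, Function.Involutive]

theorem capHeight_cap (l : IsOkadaPairing σ h) (a : ArcNode N) :
    capHeight i σ h (cap i σ a) = capHeight i σ h a := by
  have := l.involutive
  have := l.ne
  have := l.height_partner
  grind [cap, capHeight, Function.Involutive]

theorem capHeight_le (l : IsOkadaPairing σ h) {a : ArcNode N} (hlo : a ≠ lower i)
    (hhi : a ≠ upper i) : capHeight i σ h a ≤ h a := by
  have := l.height_partner a
  grind [capHeight]

theorem gArcs_adj_lower_upper (i : Fin (N - 1)) :
    (OkadaDiagram.gArcs i).graph.Adj (lower i) (upper i) :=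
  ⟨lower_ne_upper i, Or.inl (Or.inr (Or.inl ⟨_, _, rfl, rfl, rfl, rfl⟩))⟩

theorem gArcs_adj_inr_inr (i : Fin (N - 1)) : (OkadaDiagram.gArcs i).graph.Adj
    (Sum.inr ⟨i.val, by omega⟩) (Sum.inr ⟨i.val + 1, by omega⟩) :=
  ⟨by simp, Or.inl (Or.inr (Or.inr ⟨_, _, rfl, rfl, rfl, rfl⟩))⟩

theorem gArcs_adj_inl_inr {j : Fin N} (hlo : Sum.inl j ≠ lower i) (hhi : Sum.inl j ≠ upper i) :
    (OkadaDiagram.gArcs i).graph.Adj (Sum.inl j) (Sum.inr j) := by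
  simp only [lower, upper, ne_eq, Sum.inl.injEq, Fin.ext_iff] at hlo hhi
  exact ⟨by simp, Or.inl (Or.inl ⟨j, hlo, hhi, rfl, rfl⟩)⟩

theorem reachable_nodeSnd_nodeOuter (D : LabelledArcs N) {a : ArcNode N} (hlo : a ≠ lower i)
    (hhi : a ≠ upper i) :
    (glue (OkadaDiagram.gArcs i) D).Reachable (nodeSnd a) (nodeOuter a) := by
  rcases a with j | j
  · exact (glue_adj_fst (gArcs_adj_inl_inr hlo hhi)).symm.reachable
  · rfl

theorem glue_gArcs_adj (D : LabelledArcs N) (i : Fin (N - 1)) :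
    (glue (OkadaDiagram.gArcs i) D).Adj (nodeSnd (lower i)) (nodeSnd (upper i)) :=
  glue_adj_fst (gArcs_adj_inr_inr i)

theorem nodeOuter_foldLeft {w : Fin 3 × Fin N} (hw : w.1 ≠ 1) : nodeOuter (foldLeft w) = w := by
  obtain ⟨c, j⟩ := w
  fin_cases c
  · rfl
  · exact absurd rfl hw
  · rfl

theorem nodeSnd_foldLeft {w : Fin 3 × Fin N} (hw : w.1 = 1) : nodeSnd (foldLeft w) = w := by
  obtain ⟨c, j⟩ := w
  obtain rfl : c = 1 := hw
  rfl

/-- The boundary node at the end of the strand of `g_i ∘ D` through a vertex, or `none` if the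
vertex lies on a loop, when `σ` is the pairing of `D`. -/
def capEnd (i : Fin (N - 1)) (σ : ArcNode N → ArcNode N) (w : Fin 3 × Fin N) :
    Option (ArcNode N) :=
  if w.1 = 1 ∧ (foldLeft w = lower i ∨ foldLeft w = upper i) then
    if σ (lower i) = upper i then none else some (σ (foldLeft w))
  else some (foldLeft w)

theorem capEnd_of_ne {w : Fin 3 × Fin N} (hw : w.1 ≠ 1) : capEnd i σ w = some (foldLeft w) := by
  simp [capEnd, hw]

theorem capEnd_nodeOuter (a : ArcNode N) : capEnd i σ (nodeOuter a) = some a := by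
  rcases a with a | a <;> simp [capEnd, foldLeft, nodeOuter]

theorem capEnd_nodeSnd (a : ArcNode N) : capEnd i σ (nodeSnd a) =
    if a = lower i ∨ a = upper i then if σ (lower i) = upper i then none else some (σ a)
    else some a := by
  rcases a with a | a
  · simp only [capEnd, foldLeft, nodeSnd, true_and]
    rfl
  · simp [capEnd, foldLeft, nodeSnd, lower, upper]

theorem capEnd_of_gArcs_adj (l : IsOkadaPairing σ h) {a b : ArcNode N}
    (hab : (OkadaDiagram.gArcs i).graph.Adj a b) :
    capEnd i σ (nodeFst a) = capEnd i σ (nodeFst b) ∨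
      capEnd i σ (nodeFst a) = (capEnd i σ (nodeFst b)).map (cap i σ) := by
  have := l.involutive
  have := l.ne
  have := lower_ne_upper i
  have capEnd_inl (j : Fin N) : capEnd i σ (nodeFst (Sum.inl j)) = some (Sum.inl j) :=
    capEnd_nodeOuter (Sum.inl j)
  have capEnd_inr (j : Fin N) :
      capEnd i σ (nodeFst (Sum.inr j)) = capEnd i σ (nodeSnd (Sum.inl j)) := rfl
  have eq_lower {j : Fin N} (hj : j.val = i.val) : Sum.inl j = lower i :=
    congrArg Sum.inl (Fin.ext hj)
  have eq_upper {j : Fin N} (hj : j.val = i.val + 1) : Sum.inl j = upper i :=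
    congrArg Sum.inl (Fin.ext hj)
  obtain ⟨-, (⟨j, h1, h2, rfl, rfl⟩ | ⟨j, k, hj, hk, rfl, rfl⟩ | ⟨j, k, hj, hk, rfl, rfl⟩) |
    (⟨j, h1, h2, rfl, rfl⟩ | ⟨j, k, hj, hk, rfl, rfl⟩ | ⟨j, k, hj, hk, rfl, rfl⟩)⟩ := hab <;>
  simp only [capEnd_inl, capEnd_inr, capEnd_nodeSnd] <;>
  grind [cap, Function.Involutive, lower, upper]

theorem reachable_of_capEnd_nodeSnd (l : IsOkadaPairing σ h) {a b : ArcNode N}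
    (hab : capEnd i σ (nodeSnd a) = some b) :
    (glue (OkadaDiagram.gArcs i) (ofPairing σ h)).Reachable (nodeSnd a) (nodeOuter b) := by
  rw [capEnd_nodeSnd] at hab
  split_ifs at hab with ha hloop <;> obtain rfl := Option.some_injective _ hab
  · refine (glue_adj_snd l a).reachable.trans (reachable_nodeSnd_nodeOuter _ ?_ ?_) <;>
      grind [l.ne, l.involutive a]
  · rw [not_or] at ha
    exact reachable_nodeSnd_nodeOuter _ ha.1 ha.2

theorem reachable_of_capEnd (l : IsOkadaPairing σ h) {v : Fin 3 × Fin N} {a : ArcNode N}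
    (hva : capEnd i σ v = some a) :
    (glue (OkadaDiagram.gArcs i) (ofPairing σ h)).Reachable v (nodeOuter a) := by
  by_cases hv : v.1 = 1
  · rw [← nodeSnd_foldLeft hv] at hva ⊢
    exact reachable_of_capEnd_nodeSnd l hva
  · obtain rfl := Option.some_injective _ ((capEnd_of_ne hv).symm.trans hva)
    rw [nodeOuter_foldLeft hv]

theorem reachable_cap (l : IsOkadaPairing σ h) (a : ArcNode N) :
    (glue (OkadaDiagram.gArcs i) (ofPairing σ h)).Reachable (nodeOuter a)
      (nodeOuter (cap i σ a)) := by
  have lower_upper : (glue (OkadaDiagram.gArcs i) (ofPairing σ h)).Reachable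
      (nodeOuter (lower i)) (nodeOuter (upper i)) :=
    (glue_adj_fst (gArcs_adj_lower_upper i)).reachable
  have nodeSnd_partner (a : ArcNode N) (hlo : a ≠ lower i) (hhi : a ≠ upper i) :
      (glue (OkadaDiagram.gArcs i) (ofPairing σ h)).Reachable (nodeOuter a) (nodeSnd (σ a)) :=
    (reachable_nodeSnd_nodeOuter _ hlo hhi).symm.trans (glue_adj_snd l a).reachable
  unfold cap
  split_ifs with hlo hhi hσlo hσhi
  · exact hlo ▸ lower_upper
  · exact hhi ▸ lower_upper.symm
  · refine (hσlo ▸ nodeSnd_partner a hlo hhi).trans <|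
      (glue_gArcs_adj _ i).reachable.trans (reachable_of_capEnd_nodeSnd l ?_)
    grind [capEnd_nodeSnd, l.involutive a]
  · refine (hσhi ▸ nodeSnd_partner a hlo hhi).trans <|
      (glue_gArcs_adj _ i).symm.reachable.trans (reachable_of_capEnd_nodeSnd l ?_)
    grind [capEnd_nodeSnd, l.involutive a, l.involutive (lower i)]
  · exact (nodeSnd_partner a hlo hhi).trans (reachable_nodeSnd_nodeOuter _ hσlo hσhi)

theorem isResolution_cap (l : IsOkadaPairing σ h) :
    (glued (OkadaDiagram.gArcs i) (ofPairing σ h)).IsResolution nodeOuter (cap i σ)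
      (capEnd i σ) where
  involutive := cap_involutive l
  boundary := capEnd_nodeOuter
  adj v w hvw := by
    rcases glue_adj.1 hvw with ⟨a, b, hab, rfl, rfl⟩ | ⟨a, b, hab, rfl, rfl⟩
    · exact capEnd_of_gArcs_adj l hab
    · obtain rfl := l.adj_iff.1 hab
      have := l.involutive
      have := l.ne
      simp only [capEnd_nodeSnd]
      grind [cap, Function.Involutive]
  reachable v a hva := reachable_of_capEnd l hva
  reachable_partner := reachable_cap l

theorem gArcs_height_lower (i : Fin (N - 1)) :
    (OkadaDiagram.gArcs i).height (lower i) = i.val + 1 := by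
  simp [OkadaDiagram.gArcs, level_lower]

theorem gArcs_height_upper (i : Fin (N - 1)) :
    (OkadaDiagram.gArcs i).height (upper i) = i.val + 1 := by
  simp [OkadaDiagram.gArcs, level_upper]

theorem gArcs_height_inl {j : Fin N} (hhi : Sum.inl j ≠ upper i) :
    (OkadaDiagram.gArcs i).height (Sum.inl j) = ArcNode.level (Sum.inl j) := by
  refine if_neg fun h => hhi (congrArg Sum.inl (Fin.ext ?_))
  simpa [ArcNode.level] using h

theorem capHeight_le_gArcs_height_inl (l : IsOkadaPairing σ h) (j : Fin N) :
    capHeight i σ h (Sum.inl j) ≤ (OkadaDiagram.gArcs i).height (Sum.inl j) := by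
  by_cases hlo : Sum.inl j = lower i
  · rw [hlo, gArcs_height_lower, capHeight, if_pos (Or.inl rfl)]
  by_cases hhi : Sum.inl j = upper i
  · rw [hhi, gArcs_height_upper, capHeight, if_pos (Or.inr rfl)]
  exact ((capHeight_le l hlo hhi).trans (l.le_level _)).trans_eq (gArcs_height_inl hhi).symm

theorem capHeight_le_of_capEnd_nodeSnd (l : IsOkadaPairing σ h) {a b : ArcNode N}
    (hab : capEnd i σ (nodeSnd a) = some b) : capHeight i σ h b ≤ h a := by
  rw [capEnd_nodeSnd] at hab
  grind [capHeight, l.involutive a, l.ne a, l.height_partner a]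

theorem capHeight_le_of_capEnd_nodeFst (l : IsOkadaPairing σ h) {a b : ArcNode N}
    (hab : capEnd i σ (nodeFst a) = some b) :
    capHeight i σ h b ≤ (OkadaDiagram.gArcs i).height a := by
  rcases a with j | j
  · obtain rfl := Option.some_injective _ ((capEnd_nodeOuter (Sum.inl j)).symm.trans hab)
    exact capHeight_le_gArcs_height_inl l j
  change capEnd i σ (nodeSnd (Sum.inl j)) = some b at hab
  change capHeight i σ h b ≤ (OkadaDiagram.gArcs i).height (Sum.inl j)
  by_cases hhi : Sum.inl j = upper i
  · have := l.le_level (lower i)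
    rw [hhi, capEnd_nodeSnd] at hab
    rw [hhi, gArcs_height_upper]
    grind [capHeight, l.involutive (upper i), level_lower]
  · exact ((capHeight_le_of_capEnd_nodeSnd l hab).trans (l.le_level _)).trans_eq
      (gArcs_height_inl hhi).symm

theorem exists_reachable_capHeight_mem (l : IsOkadaPairing σ h) (a : ArcNode N) :
    ∃ v, (glue (OkadaDiagram.gArcs i) (ofPairing σ h)).Reachable (nodeOuter a) v ∧
      capHeight i σ h a ∈ (glued (OkadaDiagram.gArcs i) (ofPairing σ h)).labels v := by
  unfold capHeight
  split_ifs with ha hσa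
  · refine ⟨nodeOuter a, .rfl, Or.inl ⟨a, ?_⟩⟩
    rcases ha with rfl | rfl
    · exact ⟨rfl, (gArcs_height_lower i).symm⟩
    · exact ⟨rfl, (gArcs_height_upper i).symm⟩
  · rw [not_or] at ha
    have outer_partner := (reachable_nodeSnd_nodeOuter (ofPairing σ h) ha.1 ha.2).symm.trans
      (glue_adj_snd l a).reachable
    have lower_upper := (glue_gArcs_adj (ofPairing σ h) i).reachable
    have outer_lower : (glue (OkadaDiagram.gArcs i) (ofPairing σ h)).Reachable (nodeOuter a)
        (nodeSnd (lower i)) := by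
      rcases hσa with e | e <;> rw [e] at outer_partner
      · exact outer_partner
      · exact outer_partner.trans lower_upper.symm
    rcases min_choice (h (lower i)) (h (upper i)) with e | e <;> rw [e]
    · exact ⟨_, outer_lower, Or.inr ⟨lower i, rfl, rfl⟩⟩
    · exact ⟨_, outer_lower.trans lower_upper, Or.inr ⟨upper i, rfl, rfl⟩⟩
  · rw [not_or] at ha
    exact ⟨_, (reachable_nodeSnd_nodeOuter _ ha.1 ha.2).symm, Or.inr ⟨a, rfl, rfl⟩⟩

theorem gArcs_comp (l : IsOkadaPairing σ h) : comp (OkadaDiagram.gArcs i) (ofPairing σ h) =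
    ofPairing (cap i σ) (capHeight i σ h) :=
  comp_eq_ofPairing (isResolution_cap l) (capHeight_cap l)
    (fun _ _ => capHeight_le_of_capEnd_nodeFst l) (fun _ _ => capHeight_le_of_capEnd_nodeSnd l)
    (exists_reachable_capHeight_mem l)

theorem loops_gArcs_of_ne (l : IsOkadaPairing σ h) (hσ : σ (lower i) ≠ upper i) (k : ℕ) :
    loops (OkadaDiagram.gArcs i) (ofPairing σ h) k = 0 := by
  rw [loops_eq_ncard_closedComponents, (isResolution_cap l).closedComponents_eq_empty,
    Set.ncard_empty]
  grind [capEnd]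

theorem eq_of_capEnd_eq_none {w : Fin 3 × Fin N} (hw : capEnd i σ w = none) :
    w = nodeSnd (lower i) ∨ w = nodeSnd (upper i) := by
  unfold capEnd at hw
  split_ifs at hw with hmid hσ
  rw [← nodeSnd_foldLeft hmid.1]
  exact hmid.2.imp (congrArg nodeSnd) (congrArg nodeSnd)

theorem le_of_mem_labels_nodeSnd (l : IsOkadaPairing σ h) {j : Fin N} {n : ℕ}
    (hhi : h (Sum.inl j) ≤ i.val + 1)
    (hn : n ∈ (glued (OkadaDiagram.gArcs i) (ofPairing σ h)).labels (nodeSnd (Sum.inl j))) :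
    h (Sum.inl j) ≤ n := by
  rcases hn with ⟨b, hb, rfl⟩ | ⟨b, hb, rfl⟩
  · obtain rfl : b = Sum.inr j := nodeFst_injective hb
    change h (Sum.inl j) ≤ if _ then _ else _
    split_ifs
    · exact hhi
    · exact l.le_level (Sum.inl j)
  · rw [nodeSnd_injective hb]
    rfl

theorem minLabel_loop (l : IsOkadaPairing σ h) (hσ : σ (lower i) = upper i) :
    (glued (OkadaDiagram.gArcs i) (ofPairing σ h)).minLabel
      ((glue (OkadaDiagram.gArcs i) (ofPairing σ h)).connectedComponentMk (nodeSnd (lower i))) =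
      h (lower i) := by
  have h_upper : h (upper i) = h (lower i) := hσ ▸ l.height_partner (lower i)
  have hle : h (lower i) ≤ i.val + 1 := l.le_level (lower i)
  refine LabelledGraph.minLabel_eq (fun w hw n hn => ?_)
    ⟨nodeSnd (lower i), .rfl, Or.inr ⟨lower i, rfl, rfl⟩⟩
  have capEnd_eq : capEnd i σ w = none := by
    have := (isResolution_cap l).eq_or_eq_map hw
    simpa [capEnd_nodeSnd, hσ, eq_comm] using this
  rcases eq_of_capEnd_eq_none capEnd_eq with rfl | rfl
  · exact le_of_mem_labels_nodeSnd l hle hn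
  · rw [← h_upper] at hle ⊢
    exact le_of_mem_labels_nodeSnd l hle hn

theorem loops_gArcs_of_eq (l : IsOkadaPairing σ h) (hσ : σ (lower i) = upper i) (k : ℕ) :
    loops (OkadaDiagram.gArcs i) (ofPairing σ h) k = if k = h (lower i) then 1 else 0 := by
  have capEnd_lower : capEnd i σ (nodeSnd (lower i)) = none := by
    rw [capEnd_nodeSnd, if_pos (Or.inl rfl), if_pos hσ]
  rw [loops_eq_ncard_closedComponents, (isResolution_cap l).ncard_closedComponents_of_unique
    capEnd_lower fun w hw => ?_]
  · simp only [← minLabel_loop l hσ]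
    rfl
  · rcases eq_of_capEnd_eq_none hw with rfl | rfl
    · rfl
    · exact (glue_gArcs_adj _ i).reachable

theorem cap_swap_of_gArcs_adj {a b : ArcNode N} (hab : (OkadaDiagram.gArcs i).graph.Adj a b) :
    cap i Sum.swap a = b := by
  obtain ⟨-, (⟨j, h1, h2, rfl, rfl⟩ | ⟨j, k, hj, hk, rfl, rfl⟩ | ⟨j, k, hj, hk, rfl, rfl⟩) |
    (⟨j, h1, h2, rfl, rfl⟩ | ⟨j, k, hj, hk, rfl, rfl⟩ | ⟨j, k, hj, hk, rfl, rfl⟩)⟩ := hab <;>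
  simp_all [cap, lower, upper, Fin.ext_iff]

end LabelledArcs

namespace IsOkadaPairing

open ArcNode LabelledArcs

variable {N : ℕ} {σ : ArcNode N → ArcNode N} {h : ArcNode N → ℕ} {i : Fin (N - 1)}

theorem eq_iff (l : IsOkadaPairing σ h) {a b : ArcNode N} : σ a = b ↔ a = σ b :=
  l.involutive.eq_iff

theorem pos_ne (l : IsOkadaPairing σ h) (a : ArcNode N) : (σ a).pos ≠ a.pos := fun e =>
  l.ne a (pos_eq_pos_iff.1 e)

theorem height_mod_two (l : IsOkadaPairing σ h) (a : ArcNode N) :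
    h a % 2 = max a.pos (σ a).pos % 2 ∧ a.pos % 2 ≠ (σ a).pos % 2 := by
  have ha := l.parity a
  have hσa := l.parity (σ a)
  rw [l.involutive, l.height_partner] at hσa
  have := l.pos_ne a
  omega

theorem upper_partner_ne (l : IsOkadaPairing σ h) (hσ : σ (lower i) ≠ upper i) :
    σ (upper i) ≠ lower i := fun e =>
  hσ (l.eq_iff.1 e).symm

theorem partner_config (l : IsOkadaPairing σ h) (hσ : σ (lower i) ≠ upper i) :
    (σ (lower i)).pos < i.val ∧ i.val + 1 < (σ (upper i)).pos ∨
      i.val + 1 < (σ (upper i)).pos ∧ (σ (upper i)).pos < (σ (lower i)).pos ∧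
        h (lower i) < h (upper i) ∨
      (σ (upper i)).pos < (σ (lower i)).pos ∧ (σ (lower i)).pos < i.val ∧
        h (upper i) < h (lower i) := by
  have inside_lower := l.inside (lower i) (upper i)
  have inside_upper := l.inside (σ (upper i)) (lower i)
  have inside_partner := l.inside (σ (lower i)) (σ (upper i))
  have ne_lower := l.pos_ne (lower i)
  have ne_upper := l.pos_ne (upper i)
  have ne_upper' := mt pos_eq_pos_iff.1 hσ
  have ne_lower' := mt pos_eq_pos_iff.1 (l.upper_partner_ne hσ)
  have ne_partner : (σ (lower i)).pos ≠ (σ (upper i)).pos := fun e =>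
    lower_ne_upper i (l.involutive.injective (pos_eq_pos_iff.1 e))
  have := pos_lower i
  have := pos_upper i
  simp only [l.involutive _, l.height_partner] at *
  omega

theorem cap_cases (l : IsOkadaPairing σ h) (i : Fin (N - 1)) (a : ArcNode N) :
    ((a = lower i ∧ cap i σ a = upper i ∨ a = upper i ∧ cap i σ a = lower i) ∧
      capHeight i σ h a = i.val + 1) ∨
    (σ (lower i) ≠ upper i ∧
      (a = σ (lower i) ∧ cap i σ a = σ (upper i) ∨ a = σ (upper i) ∧ cap i σ a = σ (lower i)) ∧
      capHeight i σ h a = min (h (lower i)) (h (upper i))) ∨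
    ((a ≠ lower i ∧ a ≠ upper i) ∧ (σ a ≠ lower i ∧ σ a ≠ upper i) ∧ cap i σ a = σ a ∧
      capHeight i σ h a = h a) := by
  have := lower_ne_upper i
  have eq_iff (b c : ArcNode N) : σ b = c ↔ b = σ c := l.eq_iff
  by_cases σ a = lower i <;> by_cases σ a = upper i <;> grind [cap, capHeight]

theorem cap_inside_of_other (l : IsOkadaPairing σ h) {a b : ArcNode N}
    (ha : a ≠ lower i ∧ a ≠ upper i) (hσa : σ a ≠ lower i ∧ σ a ≠ upper i)
    (hab : a.pos < b.pos) (hba : b.pos < (σ a).pos) :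
    a.pos < (cap i σ b).pos ∧ (cap i σ b).pos < (σ a).pos ∧ h a < capHeight i σ h b := by
  have inside_b := l.inside a b
  have inside_lower := l.inside a (lower i)
  have inside_upper := l.inside a (upper i)
  have := l.le_level (lower i)
  have := pos_lower i
  have := pos_upper i
  have := level_lower i
  simp only [ne_eq, ← pos_eq_pos_iff] at ha hσa
  rcases l.cap_cases i b with ⟨⟨rfl, e⟩ | ⟨rfl, e⟩, eh⟩ | ⟨-, ⟨rfl, e⟩ | ⟨rfl, e⟩, eh⟩ |
    ⟨-, -, e, eh⟩ <;> rw [e, eh] <;>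
    (try simp only [l.involutive _, l.height_partner] at *) <;> omega

theorem cap_inside_of_partner (l : IsOkadaPairing σ h) (hσ : σ (lower i) ≠ upper i) {b : ArcNode N}
    (first : min (σ (lower i)).pos (σ (upper i)).pos < b.pos)
    (last : b.pos < max (σ (lower i)).pos (σ (upper i)).pos) :
    min (σ (lower i)).pos (σ (upper i)).pos < (cap i σ b).pos ∧
      (cap i σ b).pos < max (σ (lower i)).pos (σ (upper i)).pos ∧
      min (h (lower i)) (h (upper i)) < capHeight i σ h b := by
  have config := l.partner_config hσ
  have := l.height_mod_two (lower i)
  have := l.le_level (lower i)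
  have := level_lower i
  have := pos_lower i
  have := pos_upper i
  rcases l.cap_cases i b with ⟨⟨rfl, e⟩ | ⟨rfl, e⟩, eh⟩ | ⟨-, ⟨rfl, e⟩ | ⟨rfl, e⟩, eh⟩ |
    ⟨ne, ne', e, eh⟩ <;> rw [e, eh]
  · omega
  · omega
  · omega
  · omega
  · have partner_ne {c : ArcNode N} (hc : b ≠ c) : (σ b).pos ≠ (σ c).pos := fun e =>
      hc (l.involutive.injective (pos_eq_pos_iff.1 e))
    have := partner_ne ne.1
    have := partner_ne ne.2
    simp only [ne_eq, ← pos_eq_pos_iff] at ne ne'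
    rcases config with c | c | c
    · have := l.inside (σ (lower i)) b
      have := l.inside (upper i) b
      simp only [l.involutive _, l.height_partner] at *
      omega
    · have := l.inside (lower i) b
      have := l.inside (upper i) (σ b)
      simp only [l.involutive _] at *
      omega
    · have := l.inside (σ (upper i)) b
      have := l.inside (σ (lower i)) (σ b)
      simp only [l.involutive _, l.height_partner] at *
      omega

theorem one_le_capHeight (l : IsOkadaPairing σ h) (a : ArcNode N) : 1 ≤ capHeight i σ h a := by
  have := l.one_le
  rcases l.cap_cases i a with ⟨-, e⟩ | ⟨-, -, e⟩ | ⟨-, -, -, e⟩ <;> grind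

theorem capHeight_le_level (l : IsOkadaPairing σ h) (a : ArcNode N) :
    capHeight i σ h a ≤ a.level := by
  have := l.le_level a
  have := l.height_partner (lower i)
  have := l.height_partner (upper i)
  have := level_lower i
  have := level_upper i
  rcases l.cap_cases i a with ⟨⟨rfl, -⟩ | ⟨rfl, -⟩, e⟩ | ⟨-, ⟨rfl, -⟩ | ⟨rfl, -⟩, e⟩ |
    ⟨-, -, -, e⟩ <;> omega

theorem cap_inside (l : IsOkadaPairing σ h) (a b : ArcNode N) (hab : a.pos < b.pos)
    (hba : b.pos < (cap i σ a).pos) :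
    a.pos < (cap i σ b).pos ∧ (cap i σ b).pos < (cap i σ a).pos ∧
      capHeight i σ h a < capHeight i σ h b := by
  have := pos_lower i
  have := pos_upper i
  rcases l.cap_cases i a with ⟨⟨rfl, e⟩ | ⟨rfl, e⟩, -⟩ | ⟨hσ, ⟨rfl, e⟩ | ⟨rfl, e⟩, eh⟩ |
    ⟨ha, hσa, e, eh⟩ <;> rw [e] at hba ⊢
  · omega
  · omega
  · have := l.cap_inside_of_partner hσ (b := b) (by omega) (by omega)
    rw [eh]
    omega
  · have := l.cap_inside_of_partner hσ (b := b) (by omega) (by omega)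
    rw [eh]
    omega
  · rw [eh]
    exact l.cap_inside_of_other ha hσa hab hba

theorem cap_parity (l : IsOkadaPairing σ h) (a : ArcNode N) (ha : a.pos < (cap i σ a).pos) :
    capHeight i σ h a % 2 = (cap i σ a).pos % 2 ∧ a.pos % 2 ≠ (cap i σ a).pos % 2 := by
  have := pos_lower i
  have := pos_upper i
  have := l.height_mod_two (lower i)
  have := l.height_mod_two (upper i)
  rcases l.cap_cases i a with ⟨⟨rfl, e⟩ | ⟨rfl, e⟩, eh⟩ | ⟨hσ, ⟨rfl, e⟩ | ⟨rfl, e⟩, eh⟩ |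
    ⟨-, -, e, eh⟩ <;> rw [e] at ha ⊢ <;> rw [eh]
  · omega
  · omega
  · have := l.partner_config hσ
    omega
  · have := l.partner_config hσ
    omega
  · exact l.parity a ha

protected theorem cap (l : IsOkadaPairing σ h) (i : Fin (N - 1)) :
    IsOkadaPairing (cap i σ) (capHeight i σ h) where
  involutive := cap_involutive l
  ne a := by
    have := lower_ne_upper i
    have := l.ne a
    have := l.involutive.injective.ne (lower_ne_upper i)
    rcases l.cap_cases i a with ⟨h, -⟩ | ⟨-, h, -⟩ | ⟨-, -, h, -⟩ <;> grind
  height_partner := capHeight_cap l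
  one_le := l.one_le_capHeight
  le_level := l.capHeight_le_level
  inside := l.cap_inside
  parity := l.cap_parity

end IsOkadaPairing

theorem sum_alternating_ite_mem_Icc {M I N : ℕ} (hI : I < N) (parity : M % 2 = (I + 1) % 2)
    (k : ℕ) :
    ∑ j ∈ Finset.Ico (k + 1) N,
        (-1 : ℤ) ^ (j - (k + 1)) * (if M ≤ j ∧ j ≤ I then 1 else 0) =
      if M ≤ k ∧ k < I ∧ (I - k) % 2 = 1 then 1 else 0 := by
  induction hn : N - k generalizing k with
  | zero =>
    rw [Finset.Ico_eq_empty (by omega), Finset.sum_empty, if_neg (by omega)]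
  | succ n ih =>
    by_cases hk : k + 1 < N
    · have shift : ∑ j ∈ Finset.Ico (k + 1 + 1) N,
          (-1 : ℤ) ^ (j - (k + 1)) * (if M ≤ j ∧ j ≤ I then 1 else 0) =
          -∑ j ∈ Finset.Ico (k + 1 + 1) N,
            (-1 : ℤ) ^ (j - (k + 1 + 1)) * (if M ≤ j ∧ j ≤ I then 1 else 0) := by
        rw [← Finset.sum_neg_distrib]
        refine Finset.sum_congr rfl fun j hj => ?_
        rw [Finset.mem_Ico] at hj
        rw [show j - (k + 1) = j - (k + 1 + 1) + 1 by omega, pow_succ, mul_neg_one, neg_mul]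
      rw [Finset.sum_eq_sum_Ico_succ_bot hk, shift, ih (k + 1) (by omega), Nat.sub_self, pow_zero,
        one_mul]
      split_ifs <;> omega
    · rw [Finset.Ico_eq_empty (by omega), Finset.sum_empty, if_neg (by omega)]

namespace LabelledArcs

open ArcNode OkadaDiagram

variable {N : ℕ} {σ : ArcNode N → ArcNode N} {h : ArcNode N → ℕ} {i : Fin (N - 1)}

/-- The contribution, `0` or `1`, of the node `a` to `2 n_j(D)` for a diagram `D` with labels
`h`. -/
def passages (h : ArcNode N → ℕ) (j : ℕ) (a : ArcNode N) : ℕ :=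
  if h a ≤ j ∧ j < a.level then 1 else 0

theorem boxes_eq_sum_passages (D : LabelledArcs N) (j : ℕ) :
    boxes D j = (∑ a, passages D.height j a) / 2 := by
  classical
  rw [boxes, Set.ncard_eq_toFinset_card']
  simp only [passages, ← Finset.card_filter]
  congr 2
  ext a
  simp

theorem boxes_ofPairing (σ : ArcNode N → ArcNode N) (h : ArcNode N → ℕ) (j : ℕ) :
    boxes (ofPairing σ h) j = (∑ a, passages h j a) / 2 :=
  boxes_eq_sum_passages _ j

theorem boxes_gArcs (i : Fin (N - 1)) (j : ℕ) :
    boxes (gArcs i) j = if j = i.val + 1 then 1 else 0 := by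
  have sum : ∑ a, passages (gArcs i).height j a = _ :=
    Fintype.sum_eq_add (upper i) (Sum.inr ⟨i.val + 1, by omega⟩) (by simp [upper]) fun a ha => by
      have : a.level ≠ i.val + 2 := by
        rcases a with a | a <;> simpa [upper, level, Fin.ext_iff] using ha
      have := gArcs_height i a
      exact if_neg (by omega)
  rw [boxes_eq_sum_passages, sum]
  simp only [passages, gArcs, upper, level]
  split_ifs <;> omega

theorem capHeight_lower : capHeight i σ h (lower i) = i.val + 1 := if_pos (Or.inl rfl)

theorem capHeight_upper : capHeight i σ h (upper i) = i.val + 1 := if_pos (Or.inr rfl)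

theorem capHeight_partner (l : IsOkadaPairing σ h) (hσ : σ (lower i) ≠ upper i) :
    capHeight i σ h (σ (lower i)) = min (h (lower i)) (h (upper i)) ∧
      capHeight i σ h (σ (upper i)) = min (h (lower i)) (h (upper i)) := by
  simp [capHeight, l.involutive _, l.ne, hσ, l.upper_partner_ne hσ]

theorem sum_passages_capHeight_sub (l : IsOkadaPairing σ h) (j : ℕ) :
    ((∑ a, passages (capHeight i σ h) j a : ℕ) : ℤ) - (∑ a, passages h j a : ℕ) =
      ∑ a ∈ {lower i, upper i, σ (lower i), σ (upper i)},
        ((passages (capHeight i σ h) j a : ℤ) - passages h j a) := by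
  rw [Nat.cast_sum, Nat.cast_sum, ← Finset.sum_sub_distrib]
  refine (Finset.sum_subset (Finset.subset_univ _) fun a _ ha => ?_).symm
  simp only [Finset.mem_insert, Finset.mem_singleton, not_or] at ha
  have e : capHeight i σ h a = h a := by
    have := l.cap_cases i a
    grind
  rw [passages, passages, e, sub_self]

theorem sum_passages_capHeight_of_ne (l : IsOkadaPairing σ h) (hσ : σ (lower i) ≠ upper i)
    (j : ℕ) :
    ∑ a, passages (capHeight i σ h) j a +
        2 * (if max (h (lower i)) (h (upper i)) ≤ j ∧ j ≤ i.val + 1 then 1 else 0) =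
      ∑ a, passages h j a + 2 * (if j = i.val + 1 then 1 else 0) := by
  have sum := sum_passages_capHeight_sub (i := i) l j
  have ne_partner := l.involutive.injective.ne (lower_ne_upper i)
  have lower_ne : lower i ∉ ({upper i, σ (lower i), σ (upper i)} : Finset (ArcNode N)) := by
    simp [lower_ne_upper, (l.ne _).symm, (l.upper_partner_ne hσ).symm]
  have upper_ne : upper i ∉ ({σ (lower i), σ (upper i)} : Finset (ArcNode N)) := by
    simp [(l.ne _).symm, hσ.symm]
  rw [Finset.sum_insert lower_ne, Finset.sum_insert upper_ne, Finset.sum_pair ne_partner]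
    at sum
  have partner_height := capHeight_partner l hσ
  have le_lower := l.le_level (lower i)
  have le_upper := l.le_level (upper i)
  have le_partner := l.le_level (σ (lower i))
  have le_partner' := l.le_level (σ (upper i))
  generalize ∑ a, passages (capHeight i σ h) j a = total' at *
  generalize ∑ a, passages h j a = total at *
  simp only [passages, capHeight_lower, capHeight_upper, partner_height.1, partner_height.2,
    l.height_partner, level_lower, level_upper] at sum le_lower le_upper le_partner le_partner'
  rcases le_total (h (lower i)) (h (upper i)) with le | le
  · simp only [min_eq_left le, max_eq_right le, sub_self] at sum ⊢
    grind
  · simp only [min_eq_right le, max_eq_left le, sub_self] at sum ⊢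
    grind

theorem sum_passages_capHeight_of_eq (l : IsOkadaPairing σ h) (hσ : σ (lower i) = upper i)
    (j : ℕ) :
    ∑ a, passages (capHeight i σ h) j a +
        2 * (if h (lower i) ≤ j ∧ j ≤ i.val + 1 then 1 else 0) =
      ∑ a, passages h j a + 2 * (if j = i.val + 1 then 1 else 0) := by
  have sum : ∑ a, ((passages (capHeight i σ h) j a : ℤ) - passages h j a) = _ :=
    Fintype.sum_eq_add (lower i) (upper i) (lower_ne_upper i) fun a ha => by
      have e : capHeight i σ h a = h a := by
        have := l.cap_cases i a
        grind
      rw [passages, passages, e, sub_self]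
  have height_upper := l.height_partner (lower i)
  have le := l.le_level (lower i)
  rw [hσ] at height_upper
  rw [Finset.sum_sub_distrib, passages, passages, passages, passages, capHeight_lower,
    capHeight_upper, height_upper, level_lower, level_upper] at sum
  rw [level_lower] at le
  zify
  split_ifs at sum ⊢ <;> omega

theorem yExpInt_gArcs_eq {M : ℕ} (l : IsOkadaPairing σ h) (parity : M % 2 = i.val % 2)
    (hM : ∀ j, ∑ a, passages (capHeight i σ h) j a + 2 * loops (gArcs i) (ofPairing σ h) j +
        2 * (if M ≤ j ∧ j ≤ i.val + 1 then 1 else 0) =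
      ∑ a, passages h j a + 2 * (if j = i.val + 1 then 1 else 0)) (k : ℕ) :
    yExpInt (gArcs i) (ofPairing σ h) k =
      if M ≤ k ∧ k < i.val + 1 ∧ (i.val + 1 - k) % 2 = 1 then 1 else 0 := by
  rw [yExpInt, ← sum_alternating_ite_mem_Icc (N := N) (by omega) (by omega)]
  refine Finset.sum_congr rfl fun j _ => ?_
  congr 1
  have := hM j
  rw [gArcs_comp l, boxes_gArcs, boxes_ofPairing, boxes_ofPairing]
  split_ifs at this ⊢ <;> omega

theorem yExpInt_gArcs_of_ne (l : IsOkadaPairing σ h) (hσ : σ (lower i) ≠ upper i) (k : ℕ) :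
    yExpInt (gArcs i) (ofPairing σ h) k =
      if max (h (lower i)) (h (upper i)) ≤ k ∧ k < i.val + 1 ∧ (i.val + 1 - k) % 2 = 1
      then 1 else 0 := by
  have config := l.partner_config hσ
  have := l.height_mod_two (lower i)
  have := l.height_mod_two (upper i)
  have := pos_lower i
  have := pos_upper i
  refine yExpInt_gArcs_eq l (by omega) (fun j => ?_) k
  rw [loops_gArcs_of_ne l hσ, mul_zero, add_zero, sum_passages_capHeight_of_ne l hσ]

theorem yExpInt_gArcs_of_eq (l : IsOkadaPairing σ h) (hσ : σ (lower i) = upper i) (k : ℕ) :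
    yExpInt (gArcs i) (ofPairing σ h) k =
      if h (lower i) + 1 ≤ k ∧ k < i.val + 1 ∧ (i.val + 1 - k) % 2 = 1 then 1 else 0 := by
  have parity := l.height_mod_two (lower i)
  rw [hσ, pos_lower, pos_upper] at parity
  refine yExpInt_gArcs_eq l (by omega) (fun j => ?_) k
  have le := l.le_level (lower i)
  rw [level_lower] at le
  rw [loops_gArcs_of_eq l hσ, ← sum_passages_capHeight_of_eq l hσ]
  split_ifs <;> omega

theorem yExpInt_gArcs_nonneg (l : IsOkadaPairing σ h) (i : Fin (N - 1)) (k : ℕ) :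
    0 ≤ yExpInt (gArcs i) (ofPairing σ h) k := by
  by_cases hσ : σ (lower i) = upper i
  · rw [yExpInt_gArcs_of_eq l hσ]
    split_ifs <;> simp
  · rw [yExpInt_gArcs_of_ne l hσ]
    split_ifs <;> simp

end LabelledArcs

/-! ### Factoring out an elementary diagram -/

namespace LabelledArcs

open ArcNode

variable {N : ℕ} {σ : ArcNode N → ArcNode N} {h : ArcNode N → ℕ} {i : Fin (N - 1)} {c : ArcNode N}

/-- The pairing from which `cap i` makes `σ` if `σ` pairs `i` with `i + 1`: it pairs `i + 1` with
`c`, and `i` with the node that `σ` pairs with `c`. -/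
def uncap (i : Fin (N - 1)) (c : ArcNode N) (σ : ArcNode N → ArcNode N) (a : ArcNode N) :
    ArcNode N :=
  if a = lower i then σ c
  else if a = upper i then c
  else if a = c then upper i
  else if a = σ c then lower i
  else σ a

/-- The labels that go with the pairing `uncap i c σ`. -/
def uncapHeight (i : Fin (N - 1)) (c : ArcNode N) (h : ArcNode N → ℕ) (a : ArcNode N) : ℕ :=
  if a = upper i ∨ a = c then i.val + 2
  else if a = lower i then h c
  else h a

/-- The conditions on `c` for `uncap i c σ` to be an Okada arc-diagram: `c` can be joined to
`i + 1`, with the maximal label, without crossing an arc. -/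
structure CanUncap (i : Fin (N - 1)) (c : ArcNode N) (σ : ArcNode N → ArcNode N)
    (h : ArcNode N → ℕ) : Prop where
  partner_lower : σ (lower i) = upper i
  height_lower : h (lower i) = i.val + 1
  height_le : h c ≤ i.val + 1
  lt_level : i.val + 1 < c.level
  lt_pos : i.val + 1 < c.pos
  parity : c.pos % 2 = i.val % 2
  between : ∀ a, i.val + 1 < a.pos → a.pos < c.pos →
    i.val + 1 < (σ a).pos ∧ (σ a).pos < c.pos ∧ i.val + 2 < h a

end LabelledArcs

namespace LabelledArcs.CanUncap

open ArcNode IsOkadaPairing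

variable {N : ℕ} {σ : ArcNode N → ArcNode N} {h : ArcNode N → ℕ} {i : Fin (N - 1)} {c : ArcNode N}

theorem ne (u : CanUncap i c σ h) : c ≠ lower i ∧ c ≠ upper i := by
  have := u.lt_pos
  have := pos_lower i
  have := pos_upper i
  constructor <;> rintro rfl <;> omega

theorem partner_upper (u : CanUncap i c σ h) (l : IsOkadaPairing σ h) : σ (upper i) = lower i :=
  (l.eq_iff.1 u.partner_lower).symm

theorem partner_ne (u : CanUncap i c σ h) (l : IsOkadaPairing σ h) :
    σ c ≠ lower i ∧ σ c ≠ upper i := by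
  have := u.ne
  have := u.partner_lower
  have := l.involutive (lower i)
  grind [l.eq_iff]

theorem pos_partner (u : CanUncap i c σ h) (l : IsOkadaPairing σ h) :
    (σ c).pos < i.val ∨ c.pos < (σ c).pos := by
  obtain ⟨ne_lower, ne_upper⟩ := u.partner_ne l
  rw [ne_eq, ← pos_eq_pos_iff, pos_lower] at ne_lower
  rw [ne_eq, ← pos_eq_pos_iff, pos_upper] at ne_upper
  have := u.between (σ c)
  rw [l.involutive] at this
  have := l.pos_ne c
  omega

theorem uncap_cases (u : CanUncap i c σ h) (l : IsOkadaPairing σ h) (a : ArcNode N) :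
    ((a = lower i ∧ uncap i c σ a = σ c ∨ a = σ c ∧ uncap i c σ a = lower i) ∧
      uncapHeight i c h a = h c) ∨
    ((a = upper i ∧ uncap i c σ a = c ∨ a = c ∧ uncap i c σ a = upper i) ∧
      uncapHeight i c h a = i.val + 2) ∨
    ((a ≠ lower i ∧ a ≠ upper i ∧ a ≠ c ∧ a ≠ σ c) ∧
      (σ a ≠ lower i ∧ σ a ≠ upper i ∧ σ a ≠ c ∧ σ a ≠ σ c) ∧
      uncap i c σ a = σ a ∧ uncapHeight i c h a = h a) := by
  have := lower_ne_upper i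
  have := u.ne
  have := u.partner_ne l
  have := u.partner_lower
  have := u.partner_upper l
  have := l.ne c
  have := l.involutive c
  have := l.height_partner c
  have eq_iff (b d : ArcNode N) : σ b = d ↔ b = σ d := l.eq_iff
  by_cases a = lower i <;> by_cases a = upper i <;> by_cases a = c <;> by_cases a = σ c <;>
    grind [uncap, uncapHeight]

theorem inside_lower (u : CanUncap i c σ h) (l : IsOkadaPairing σ h) {b : ArcNode N}
    (first : min i.val (σ c).pos < b.pos) (last : b.pos < max i.val (σ c).pos) :
    min i.val (σ c).pos < (uncap i c σ b).pos ∧ (uncap i c σ b).pos < max i.val (σ c).pos ∧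
      h c < uncapHeight i c h b := by
  have := u.pos_partner l
  have := u.lt_pos
  have := u.height_le
  have := pos_lower i
  have := pos_upper i
  rcases u.uncap_cases l b with ⟨⟨rfl, e⟩ | ⟨rfl, e⟩, eh⟩ | ⟨⟨rfl, e⟩ | ⟨rfl, e⟩, eh⟩ |
    ⟨ne, ne', e, eh⟩ <;> rw [e, eh]
  · omega
  · omega
  · omega
  · omega
  · simp only [ne_eq, ← pos_eq_pos_iff] at ne ne'
    have := u.between b
    have := u.between (σ b)
    have := l.inside c b
    have := l.inside (σ c) b
    simp only [l.involutive _, l.height_partner] at *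
    omega

theorem inside_upper (u : CanUncap i c σ h) (l : IsOkadaPairing σ h) {b : ArcNode N}
    (first : i.val + 1 < b.pos) (last : b.pos < c.pos) :
    i.val + 1 < (uncap i c σ b).pos ∧ (uncap i c σ b).pos < c.pos ∧
      i.val + 2 < uncapHeight i c h b := by
  have := u.pos_partner l
  have := u.between b first last
  have := pos_lower i
  have := pos_upper i
  rcases u.uncap_cases l b with ⟨⟨rfl, e⟩ | ⟨rfl, e⟩, eh⟩ | ⟨⟨rfl, e⟩ | ⟨rfl, e⟩, eh⟩ |
    ⟨-, -, e, eh⟩ <;> rw [e, eh] <;> omega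

theorem inside_other (u : CanUncap i c σ h) (l : IsOkadaPairing σ h) {a b : ArcNode N}
    (ha : a ≠ lower i ∧ a ≠ upper i ∧ a ≠ c ∧ a ≠ σ c)
    (hσa : σ a ≠ lower i ∧ σ a ≠ upper i ∧ σ a ≠ c ∧ σ a ≠ σ c)
    (hab : a.pos < b.pos) (hba : b.pos < (σ a).pos) :
    a.pos < (uncap i c σ b).pos ∧ (uncap i c σ b).pos < (σ a).pos ∧
      h a < uncapHeight i c h b := by
  have := l.inside a c
  have := l.inside a (σ c)
  have := u.between a
  have := u.between (σ a)
  have := u.height_le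
  have := u.lt_pos
  have := pos_lower i
  have := pos_upper i
  simp only [ne_eq, ← pos_eq_pos_iff] at ha hσa
  rcases u.uncap_cases l b with ⟨⟨rfl, e⟩ | ⟨rfl, e⟩, eh⟩ | ⟨⟨rfl, e⟩ | ⟨rfl, e⟩, eh⟩ |
    ⟨-, -, e, eh⟩ <;> rw [e, eh]
  iterate 4 (simp only [l.involutive _, l.height_partner] at *; omega)
  · exact l.inside a b hab hba

theorem uncap_parity (u : CanUncap i c σ h) (l : IsOkadaPairing σ h) (a : ArcNode N) :
    a.pos < (uncap i c σ a).pos → uncapHeight i c h a % 2 = (uncap i c σ a).pos % 2 ∧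
      a.pos % 2 ≠ (uncap i c σ a).pos % 2 := by
  have := u.pos_partner l
  have := u.parity
  have := u.lt_pos
  have := l.height_mod_two c
  have := l.parity a
  have := pos_lower i
  have := pos_upper i
  rcases u.uncap_cases l a with ⟨⟨rfl, e⟩ | ⟨rfl, e⟩, eh⟩ | ⟨⟨rfl, e⟩ | ⟨rfl, e⟩, eh⟩ |
    ⟨-, -, e, eh⟩ <;> rw [e, eh] <;> omega

theorem uncapHeight_le_level (u : CanUncap i c σ h) (l : IsOkadaPairing σ h) (a : ArcNode N) :
    uncapHeight i c h a ≤ a.level := by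
  have := l.le_level a
  have := l.height_partner c
  have := u.height_le
  have := u.lt_level
  have := level_lower i
  have := level_upper i
  rcases u.uncap_cases l a with ⟨⟨rfl, -⟩ | ⟨rfl, -⟩, e⟩ | ⟨⟨rfl, -⟩ | ⟨rfl, -⟩, e⟩ |
    ⟨-, -, -, e⟩ <;> omega

theorem uncap_involutive (u : CanUncap i c σ h) (l : IsOkadaPairing σ h) :
    Function.Involutive (uncap i c σ) := fun a => by
  have := l.involutive
  have := l.ne
  have := u.ne
  have := u.partner_ne l
  have := lower_ne_upper i
  rcases u.uncap_cases l a with ⟨⟨rfl, e⟩ | ⟨rfl, e⟩, -⟩ | ⟨⟨rfl, e⟩ | ⟨rfl, e⟩, -⟩ |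
    ⟨-, ne', e, -⟩ <;> rw [e]
  iterate 4 grind [uncap, Function.Involutive]
  · simp only [uncap, ne', if_false, l.involutive a]

theorem uncap_ne (u : CanUncap i c σ h) (l : IsOkadaPairing σ h) (a : ArcNode N) :
    uncap i c σ a ≠ a := by
  have := l.ne
  have := u.ne
  have := u.partner_ne l
  rcases u.uncap_cases l a with ⟨⟨rfl, e⟩ | ⟨rfl, e⟩, -⟩ | ⟨⟨rfl, e⟩ | ⟨rfl, e⟩, -⟩ |
    ⟨-, -, e, -⟩ <;> grind

theorem uncapHeight_uncap (u : CanUncap i c σ h) (l : IsOkadaPairing σ h) (a : ArcNode N) :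
    uncapHeight i c h (uncap i c σ a) = uncapHeight i c h a := by
  have := l.height_partner
  have := l.ne
  have := u.ne
  have := u.partner_ne l
  have := lower_ne_upper i
  rcases u.uncap_cases l a with ⟨⟨rfl, e⟩ | ⟨rfl, e⟩, eh⟩ | ⟨⟨rfl, e⟩ | ⟨rfl, e⟩, eh⟩ |
    ⟨-, ne', e, eh⟩ <;> rw [e, eh]
  iterate 4 grind [uncapHeight]
  · simp only [uncapHeight, ne', or_self, if_false, l.height_partner a]

theorem inside_uncap (u : CanUncap i c σ h) (l : IsOkadaPairing σ h) (a b : ArcNode N)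
    (hab : a.pos < b.pos) (hba : b.pos < (uncap i c σ a).pos) :
    a.pos < (uncap i c σ b).pos ∧ (uncap i c σ b).pos < (uncap i c σ a).pos ∧
      uncapHeight i c h a < uncapHeight i c h b := by
  have := pos_lower i
  have := pos_upper i
  have := u.lt_pos
  rcases u.uncap_cases l a with ⟨⟨rfl, e⟩ | ⟨rfl, e⟩, eh⟩ | ⟨⟨rfl, e⟩ | ⟨rfl, e⟩, eh⟩ |
    ⟨ha, hσa, e, eh⟩ <;> rw [e] at hba ⊢ <;> rw [eh]
  · have := u.inside_lower l (b := b) (by omega) (by omega)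
    omega
  · have := u.inside_lower l (b := b) (by omega) (by omega)
    omega
  · exact u.inside_upper l hab hba
  · omega
  · exact u.inside_other l ha hσa hab hba

theorem isOkadaPairing (u : CanUncap i c σ h) (l : IsOkadaPairing σ h) :
    IsOkadaPairing (uncap i c σ) (uncapHeight i c h) where
  involutive := u.uncap_involutive l
  ne := u.uncap_ne l
  height_partner := u.uncapHeight_uncap l
  one_le a := by
    have := l.one_le
    grind [uncapHeight]
  le_level := u.uncapHeight_le_level l
  inside := u.inside_uncap l
  parity := u.uncap_parity l

theorem cap_uncap (u : CanUncap i c σ h) (l : IsOkadaPairing σ h) :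
    cap i (uncap i c σ) = σ := by
  funext a
  have := u.partner_lower
  have := u.ne
  have := u.partner_ne l
  have := lower_ne_upper i
  have := l.ne
  have := l.involutive (lower i)
  have := l.involutive c
  rcases u.uncap_cases l a with ⟨⟨rfl, e⟩ | ⟨rfl, e⟩, -⟩ | ⟨⟨rfl, e⟩ | ⟨rfl, e⟩, -⟩ |
    ⟨ne, ne', e, -⟩ <;> simp only [cap, e] <;> grind [uncap]

theorem capHeight_uncap (u : CanUncap i c σ h) (l : IsOkadaPairing σ h) :
    capHeight i (uncap i c σ) (uncapHeight i c h) = h := by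
  funext a
  have := u.ne
  have := u.partner_ne l
  have := lower_ne_upper i
  have := l.height_partner
  have := u.partner_lower
  have := u.height_lower
  have := u.height_le
  rcases u.uncap_cases l a with ⟨⟨rfl, e⟩ | ⟨rfl, e⟩, eh⟩ | ⟨⟨rfl, e⟩ | ⟨rfl, e⟩, eh⟩ |
    ⟨ne, ne', e, eh⟩ <;> simp only [capHeight, e, eh] <;> grind [uncapHeight]

theorem sum_height_lt (u : CanUncap i c σ h) (l : IsOkadaPairing σ h) :
    ∑ a, h a < ∑ a, uncapHeight i c h a := by
  have := u.ne
  have lower_ne := lower_ne_upper i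
  have := l.height_partner (lower i)
  have := u.partner_lower
  have := u.height_lower
  have := u.height_le
  have le (a : ArcNode N) : h a ≤ uncapHeight i c h (Equiv.swap (lower i) c a) := by
    rw [Equiv.swap_apply_def]
    grind [uncapHeight]
  rw [← Equiv.sum_comp (Equiv.swap (lower i) c) (uncapHeight i c h)]
  refine Finset.sum_lt_sum (fun a _ => le a) ⟨upper i, Finset.mem_univ _, ?_⟩
  rw [Equiv.swap_apply_of_ne_of_ne lower_ne.symm u.ne.2.symm]
  grind [uncapHeight]

end LabelledArcs.CanUncap

/-- Arcs with equal labels are not nested, so the labels determine the pairing. -/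
theorem IsOkadaPairing.unique {N : ℕ} {σ τ : ArcNode N → ArcNode N} {h : ArcNode N → ℕ}
    (l : IsOkadaPairing σ h) (l' : IsOkadaPairing τ h) : σ = τ := by
  funext a
  induction hn : a.pos using Nat.strong_induction_on generalizing a with
  | _ n ih =>
    subst hn
    rw [← ArcNode.pos_eq_pos_iff]
    have := l.pos_ne a
    have := l'.pos_ne a
    have := l.height_partner a
    have := l'.height_partner a
    have := l.inside a (τ a)
    have := l'.inside a (σ a)
    have first (hlt : (σ a).pos < a.pos) : σ a = τ a := by
      have := ih _ hlt _ rfl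
      rw [l.involutive] at this
      exact l'.eq_iff.1 this.symm
    have first' (hlt : (τ a).pos < a.pos) : σ a = τ a := by
      have := ih _ hlt _ rfl
      rw [l'.involutive] at this
      exact (l.eq_iff.1 this).symm
    rw [← ArcNode.pos_eq_pos_iff] at first first'
    omega

theorem LabelledArcs.IsOkada.eq_of_height_eq {N : ℕ} {C D : LabelledArcs N} (hC : C.IsOkada)
    (hD : D.IsOkada) (height_eq : C.height = D.height) : C = D := by
  obtain ⟨σ, lC, eC⟩ := hC.exists_eq_ofPairing
  obtain ⟨τ, lD, eD⟩ := hD.exists_eq_ofPairing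
  rw [height_eq] at lC
  rw [eC, eD, height_eq, lC.unique lD]

theorem ArcNode.eq_or_eq_swap_of_level_eq {N : ℕ} {a b : ArcNode N} (hab : a.level = b.level) :
    a = b ∨ a = b.swap := by
  rcases a with a | a <;> rcases b with b | b <;> simpa [level, Fin.ext_iff] using hab

namespace LabelledArcs

open ArcNode

variable {N k : ℕ} {σ : ArcNode N → ArcNode N} {h : ArcNode N → ℕ} {j : Fin N} {i : Fin (N - 1)}

/-- All labels at levels above `k` are maximal. -/
def MaximalAbove (h : ArcNode N → ℕ) (k : ℕ) : Prop :=
  ∀ a, k < a.level → h a = a.level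

/-- All labels at levels above `k` are maximal, and `j + 1` is the greatest level up to `k` at which
the label of the left node is maximal. -/
structure HasTop (h : ArcNode N → ℕ) (k : ℕ) (j : Fin N) : Prop where
  above : MaximalAbove h k
  lt : j.val < k
  le : k ≤ N
  height_eq : h (Sum.inl j) = j.val + 1
  height_le : ∀ l : Fin N, j < l → l.val < k → h (Sum.inl l) ≤ l.val

theorem MaximalAbove.level_partner (above : MaximalAbove h k) (l : IsOkadaPairing σ h)
    {a : ArcNode N} (ha : k < a.level) : (σ a).level = a.level := by
  have := above a ha
  have := above (σ a)
  have := l.le_level (σ a)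
  have := l.height_partner a
  omega

theorem MaximalAbove.exists_hasTop (above : MaximalAbove h k) (l : IsOkadaPairing σ h) (hk : 0 < k)
    (hkN : k ≤ N) : ∃ j, HasTop h k j := by
  have level (j : Fin N) : h (Sum.inl j) ≤ j.val + 1 := l.le_level (Sum.inl j)
  have one_le := l.one_le
  let maximal : Finset (Fin N) := {j | j.val < k ∧ h (Sum.inl j) = j.val + 1}
  have mem_maximal (j : Fin N) : j ∈ maximal ↔ j.val < k ∧ h (Sum.inl j) = j.val + 1 :=
    Finset.mem_filter_univ j
  have zero_mem : (⟨0, by omega⟩ : Fin N) ∈ maximal :=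
    (mem_maximal _).2 ⟨hk, (level _).antisymm (one_le _)⟩
  obtain ⟨j, hj, le_j⟩ := maximal.exists_maximal ⟨_, zero_mem⟩
  rw [mem_maximal] at hj
  refine ⟨j, above, hj.1, hkN, hj.2, fun m hm hmk => ?_⟩
  by_contra! hlt
  exact hm.not_ge (le_j ((mem_maximal m).2 ⟨hmk, (level m).antisymm hlt⟩) hm.le)

namespace HasTop

theorem unique {j' : Fin N} (top : HasTop h k j) (top' : HasTop h k j') : j = j' := by
  have := top.height_eq
  have := top'.height_eq
  rcases lt_trichotomy j j' with hlt | rfl | hlt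
  · have := top.height_le j' hlt top'.lt
    omega
  · rfl
  · have := top'.height_le j hlt top.lt
    omega

theorem partner_lower (top : HasTop h k ⟨i.val, by omega⟩) (l : IsOkadaPairing σ h)
    (hik : i.val + 1 < k) : σ (lower i) = upper i := by
  have height_lower : h (lower i) = i.val + 1 := top.height_eq
  have height_upper : h (upper i) ≤ i.val + 1 :=
    top.height_le ⟨i.val + 1, by omega⟩ (Fin.lt_def.2 (Nat.lt_succ_self _)) hik
  have := l.inside (lower i) (upper i)
  have := l.le_level (σ (lower i))
  have := l.height_partner (lower i)
  have := l.pos_ne (lower i)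
  have := OkadaDiagram.pos_level (σ (lower i))
  have := pos_lower i
  have := pos_upper i
  rw [← pos_eq_pos_iff]
  omega

theorem partner_last (top : HasTop h k j) (l : IsOkadaPairing σ h) (hjk : j.val + 1 = k) :
    σ (Sum.inl j) = Sum.inr j := by
  have level : ArcNode.level (N := N) (Sum.inl j) = j.val + 1 := rfl
  have := top.height_eq
  have := l.le_level (σ (Sum.inl j))
  have := l.height_partner (Sum.inl j)
  have above (hlt : k < (σ (Sum.inl j)).level) := top.above.level_partner l hlt
  rw [l.involutive] at above
  exact (eq_or_eq_swap_of_level_eq (by omega)).resolve_left (l.ne _)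

end HasTop

/-- The node that is joined to `i + 1` in a diagram for which `HasTop` holds with the level
`i + 1`. -/
def topPartner (i : Fin (N - 1)) (k : ℕ) : ArcNode N :=
  if h : i.val + 2 < k ∧ k ≤ N then Sum.inl ⟨i.val + 2, by omega⟩
  else Sum.inr ⟨i.val + 1, by omega⟩

namespace HasTop

theorem partner_upper (top : HasTop h k ⟨i.val + 1, by omega⟩) (l : IsOkadaPairing σ h) :
    σ (upper i) = topPartner i k := by
  unfold topPartner
  split_ifs with hik
  · exact top.partner_lower (i := ⟨i.val + 1, by omega⟩) l hik.1
  · have := top.lt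
    have := top.le
    exact top.partner_last l (by dsimp only at *; omega)

theorem canUncap_inl (top : HasTop h k ⟨i.val, by omega⟩) (l : IsOkadaPairing σ h) {j : Fin N}
    (hj : j.val = i.val + 2) (hjk : j.val < k) : CanUncap i (Sum.inl j) σ h := by
  have partner_lower := top.partner_lower l (by omega)
  have pos_c : ArcNode.pos (N := N) (Sum.inl j) = i.val + 2 := hj
  have level_c : ArcNode.level (N := N) (Sum.inl j) = i.val + 3 := congrArg (· + 1) hj
  have height_c := top.height_le j (Fin.lt_def.2 (by dsimp only; omega)) hjk
  generalize (Sum.inl j : ArcNode N) = c at *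
  have ne_lower : (σ c).pos ≠ (lower i).pos := fun e => by
    rw [pos_eq_pos_iff, l.eq_iff, partner_lower, ← pos_eq_pos_iff, pos_upper] at e
    omega
  have ne_upper : (σ c).pos ≠ (upper i).pos := fun e => by
    rw [← partner_lower, pos_eq_pos_iff, l.involutive.injective.eq_iff, ← pos_eq_pos_iff,
      pos_lower] at e
    omega
  rw [pos_lower] at ne_lower
  rw [pos_upper] at ne_upper
  have := l.height_mod_two c
  have := l.le_level (σ c)
  have := l.height_partner c
  have := OkadaDiagram.pos_level (σ c)
  exact ⟨partner_lower, top.height_eq, by omega, by omega, by omega, by omega,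
    fun a _ _ => by omega⟩

theorem canUncap_inr (top : HasTop h k ⟨i.val, by omega⟩) (l : IsOkadaPairing σ h)
    (hik : i.val + 2 = k) : CanUncap i (Sum.inr ⟨i.val + 1, by omega⟩) σ h := by
  have partner_lower := top.partner_lower l (by omega)
  have swap_c : upper i = Sum.swap (Sum.inr ⟨i.val + 1, by omega⟩ : ArcNode N) := rfl
  have pos_c : ArcNode.pos (N := N) (Sum.inr ⟨i.val + 1, by omega⟩) = 2 * N - 1 - (i.val + 1) := rfl
  have level_c : ArcNode.level (N := N) (Sum.inr ⟨i.val + 1, by omega⟩) = i.val + 2 := rfl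
  generalize (Sum.inr ⟨i.val + 1, by omega⟩ : ArcNode N) = c at *
  have level_partner_ne : (σ c).level ≠ i.val + 2 := fun e => by
    rcases eq_or_eq_swap_of_level_eq (e.trans level_c.symm) with e | e
    · exact l.ne c e
    · rw [← swap_c, ← partner_lower, l.involutive.injective.eq_iff, ← pos_eq_pos_iff,
        pos_lower] at e
      omega
  have := l.le_level c
  have := l.le_level (σ c)
  have := l.height_partner c
  have above := top.above.level_partner l (a := σ c)
  rw [l.involutive] at above
  refine ⟨partner_lower, top.height_eq, by omega, by omega, by omega, by omega,
    fun a first last => ?_⟩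
  have := OkadaDiagram.pos_level a
  have := OkadaDiagram.pos_level (σ a)
  have := top.above a (by omega)
  have := top.above.level_partner l (a := a) (by omega)
  omega

theorem canUncap (top : HasTop h k ⟨i.val, by omega⟩) (l : IsOkadaPairing σ h)
    (hik : i.val + 1 < k) : CanUncap i (topPartner i k) σ h := by
  have := top.le
  unfold topPartner
  split_ifs
  · exact top.canUncap_inl l rfl (by dsimp only; omega)
  · exact top.canUncap_inr l (by omega)

end HasTop

end LabelledArcs

namespace LabelledArcs

open ArcNode OkadaDiagram

variable {N k : ℕ} {σ : ArcNode N → ArcNode N} {h : ArcNode N → ℕ} {C D : LabelledArcs N}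

theorem HasTop.maximalAbove (l : IsOkadaPairing σ h) {j : Fin N} (top : HasTop h (k + 1) j)
    (hjk : j.val = k) : MaximalAbove h k := fun a ha => by
  have level : ArcNode.level (N := N) (Sum.inl j) = j.val + 1 := rfl
  have height_eq := top.height_eq
  have height_partner := l.height_partner (Sum.inl j)
  rw [top.partner_last l (by omega)] at height_partner
  rcases Nat.lt_or_eq_of_le (Nat.succ_le_of_lt ha) with hlt | heq
  · exact top.above a hlt
  · rcases eq_or_eq_swap_of_level_eq (a := a) (b := Sum.inl j) (by omega) with rfl | rfl
    · omega
    · exact height_partner.trans height_eq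

theorem exists_hasTop (l : IsOkadaPairing σ h) (ne_level : h ≠ level) :
    ∃ (k : ℕ) (i : Fin (N - 1)), HasTop h k ⟨i.val, by omega⟩ ∧ i.val + 1 < k := by
  have above : MaximalAbove h N := fun a ha => absurd (pos_level a).2.1 (by omega)
  obtain ⟨n, hn, above⟩ : ∃ n ≤ N, MaximalAbove h n := ⟨N, le_rfl, above⟩
  induction n with
  | zero => exact absurd (funext fun a => above a (pos_level a).1) ne_level
  | succ n ih =>
    obtain ⟨j, top⟩ := above.exists_hasTop l n.succ_pos hn
    by_cases hj : j.val = n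
    · exact ih (by omega) (top.maximalAbove l hj)
    · have := top.lt
      exact ⟨n + 1, ⟨j.val, by omega⟩, top, by dsimp only; omega⟩

theorem IsOkada.exists_factorization (hD : D.IsOkada) (hne : D ≠ (OkadaDiagram.id N).val) :
    ∃ (i : Fin (N - 1)) (D' : LabelledArcs N), D'.IsOkada ∧ comp (gArcs i) D' = D ∧
      (∀ k, loops (gArcs i) D' k = 0) ∧ (∀ k, yExpInt (gArcs i) D' k = 0) ∧
      ∑ a, D.height a < ∑ a, D'.height a := by
  have ne_level : D.height ≠ level := fun e => hne (hD.eq_of_height_eq (OkadaDiagram.id N).2 e)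
  obtain ⟨σ, l, eq_ofPairing⟩ := hD.exists_eq_ofPairing
  obtain ⟨k, i, top, hik⟩ := exists_hasTop l ne_level
  have u := top.canUncap l hik
  set c := topPartner i k
  have l' := u.isOkadaPairing l
  have uncap_lower : uncap i c σ (lower i) = σ c := if_pos rfl
  have height_upper : uncapHeight i c D.height (upper i) = i.val + 2 := if_pos (Or.inl rfl)
  have hσ : uncap i c σ (lower i) ≠ upper i := uncap_lower ▸ (u.partner_ne l).2
  refine ⟨i, ofPairing (uncap i c σ) (uncapHeight i c D.height), l'.isOkada, ?_,
    loops_gArcs_of_ne l' hσ, fun n => ?_, u.sum_height_lt l⟩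
  · rw [gArcs_comp l', u.cap_uncap l, u.capHeight_uncap l, ← eq_ofPairing]
  · rw [yExpInt_gArcs_of_ne l' hσ, height_upper, if_neg]
    omega

theorem IsOkada.gArcs_comp (hD : D.IsOkada) (i : Fin (N - 1)) : (comp (gArcs i) D).IsOkada := by
  obtain ⟨σ, l, eq_ofPairing⟩ := hD.exists_eq_ofPairing
  rw [eq_ofPairing, LabelledArcs.gArcs_comp l]
  exact (l.cap i).isOkada

@[elab_as_elim]
theorem IsOkada.induction {P : (D : LabelledArcs N) → D.IsOkada → Prop}
    (id : P (OkadaDiagram.id N).val (OkadaDiagram.id N).property)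
    (gArcs_comp : ∀ (i : Fin (N - 1)) (D : LabelledArcs N) (hD : D.IsOkada),
      (∀ k, loops (gArcs i) D k = 0) → (∀ k, yExpInt (gArcs i) D k = 0) → P D hD →
      P (LabelledArcs.comp (gArcs i) D) (hD.gArcs_comp i)) (hD : D.IsOkada) : P D hD := by
  induction hn : ∑ a : ArcNode N, a.level - ∑ a, D.height a using Nat.strong_induction_on
    generalizing D with
  | _ n ih =>
    by_cases hne : D = (OkadaDiagram.id N).val
    · subst hne
      exact id
    · obtain ⟨i, D', hD', rfl, loops_eq, yExpInt_eq, sum_lt⟩ := hD.exists_factorization hne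
      have sum_le : ∑ a, D'.height a ≤ ∑ a : ArcNode N, a.level := Finset.sum_le_sum fun a _ => by
        obtain ⟨b, hb, -⟩ := hD'.matching a
        exact (hD'.height_le a b hb).trans (min_le_left _ _)
      exact gArcs_comp i D' hD' loops_eq yExpInt_eq (ih _ (by omega) hD' rfl)

theorem IsOkada.comp (hC : C.IsOkada) (hD : D.IsOkada) : (LabelledArcs.comp C D).IsOkada := by
  induction hC using IsOkada.induction with
  | id => rwa [id_comp ⟨D, hD⟩]
  | gArcs_comp i C _ _ _ ih =>
    rw [comp_assoc]
    exact ih.gArcs_comp i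

theorem yExpInt_nonneg (hC : C.IsOkada) (hD : D.IsOkada) (k : ℕ) : 0 ≤ yExpInt C D k := by
  induction hC using IsOkada.induction with
  | id => rw [yExpInt_id ⟨D, hD⟩]
  | gArcs_comp i C hC _ yExpInt_eq ih =>
    have cocycle := yExpInt_cocycle (gArcs i) C D k
    obtain ⟨σ, l, eq_ofPairing⟩ := (hC.comp hD).exists_eq_ofPairing
    have nonneg := yExpInt_gArcs_nonneg l i k
    rw [← eq_ofPairing] at nonneg
    rw [yExpInt_eq] at cocycle
    omega

theorem comp_id (hC : C.IsOkada) : comp C (OkadaDiagram.id N).val = C := by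
  induction hC using IsOkada.induction with
  | id => exact id_comp _
  | gArcs_comp i C _ _ _ ih => rw [comp_assoc, ih]

theorem loops_id_right (hC : C.IsOkada) (k : ℕ) : loops C (OkadaDiagram.id N).val k = 0 := by
  induction hC using IsOkada.induction with
  | id => exact loops_id _ k
  | gArcs_comp i C hC loops_eq _ ih =>
    have cocycle := loops_cocycle (gArcs i) C (OkadaDiagram.id N).val k
    rw [comp_id hC, loops_eq] at cocycle
    omega

theorem yExpInt_id_right (hC : C.IsOkada) (k : ℕ) : yExpInt C (OkadaDiagram.id N).val k = 0 := by
  refine Finset.sum_eq_zero fun j _ => ?_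
  rw [comp_id hC, boxes_id, loops_id_right hC]
  simp

end LabelledArcs

/-! ### Counting diagrams -/

namespace LabelledArcs

open ArcNode OkadaDiagram

variable {N k : ℕ} {σ : ArcNode N → ArcNode N} {h : ArcNode N → ℕ} {C D : LabelledArcs N}
  {i : Fin (N - 1)}

theorem uncapHeight_capHeight (l : IsOkadaPairing σ h) (height_upper : h (upper i) = i.val + 2) :
    uncapHeight i (σ (upper i)) (capHeight i σ h) = h := by
  have level_lower : h (lower i) ≤ i.val + 1 := l.le_level (lower i)
  have hσ : σ (lower i) ≠ upper i := fun e => by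
    have := l.height_partner (lower i)
    rw [e] at this
    omega
  have min_eq : min (h (lower i)) (h (upper i)) = h (lower i) := min_eq_left (by omega)
  funext a
  by_cases ha : a = upper i ∨ a = σ (upper i)
  · rw [uncapHeight, if_pos ha]
    rcases ha with rfl | rfl
    · exact height_upper.symm
    · rw [l.height_partner, height_upper]
  · have := capHeight_partner l hσ
    have := l.height_partner a
    grind [uncapHeight, capHeight, l.eq_iff]

namespace HasTop

theorem capHeight (top : HasTop h k ⟨i.val + 1, by omega⟩) (l : IsOkadaPairing σ h) :
    HasTop (capHeight i σ h) k ⟨i.val, by omega⟩ := by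
  have : h (lower i) ≤ i.val + 1 := l.le_level (lower i)
  have height_upper : h (upper i) = i.val + 2 := top.height_eq
  have lt : i.val + 1 < k := top.lt
  refine ⟨fun a ha => ?_, by dsimp only; omega, top.le, capHeight_lower, fun j hj hjk => ?_⟩
  · have above := top.above a ha
    have level_partner := top.above.level_partner l ha
    have := level_lower i
    have := level_upper i
    rw [LabelledArcs.capHeight, if_neg, if_neg, above]
    · rintro (e | e) <;> rw [e] at level_partner <;> omega
    · rintro (rfl | rfl) <;> omega
  · replace hj : i.val < j.val := hj
    by_cases ha : (Sum.inl j : ArcNode N) = upper i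
    · rw [ha, capHeight_upper]
      exact hj
    · have ne_lower : (Sum.inl j : ArcNode N) ≠ lower i := by
        simp only [lower, ne_eq, Sum.inl.injEq, Fin.ext_iff]
        omega
      refine (capHeight_le l ne_lower ha).trans (top.height_le j ?_ hjk)
      simp only [upper, Sum.inl.injEq, Fin.ext_iff] at ha
      rw [Fin.lt_def]
      dsimp only
      omega

theorem gArcs_comp (top : HasTop D.height k ⟨i.val + 1, by omega⟩) (hD : D.IsOkada) :
    HasTop (comp (gArcs i) D).height k ⟨i.val, by omega⟩ := by
  obtain ⟨σ, l, eq_ofPairing⟩ := hD.exists_eq_ofPairing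
  rw [eq_ofPairing, LabelledArcs.gArcs_comp l]
  exact top.capHeight l

theorem uncapHeight_gArcs_comp (top : HasTop D.height k ⟨i.val + 1, by omega⟩)
    (hD : D.IsOkada) :
    uncapHeight i (topPartner i k) (comp (gArcs i) D).height = D.height := by
  obtain ⟨σ, l, eq_ofPairing⟩ := hD.exists_eq_ofPairing
  conv_lhs => rw [eq_ofPairing, LabelledArcs.gArcs_comp l, ← top.partner_upper l]
  exact uncapHeight_capHeight l top.height_eq

theorem eq_of_gArcs_comp_eq (topC : HasTop C.height k ⟨i.val + 1, by omega⟩)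
    (topD : HasTop D.height k ⟨i.val + 1, by omega⟩) (hC : C.IsOkada) (hD : D.IsOkada)
    (e : comp (gArcs i) C = comp (gArcs i) D) : C = D :=
  hC.eq_of_height_eq hD <| by
    rw [← topC.uncapHeight_gArcs_comp hC, e, topD.uncapHeight_gArcs_comp hD]

end HasTop

end LabelledArcs

namespace OkadaDiagram

open LabelledArcs

variable {N : ℕ}

instance (N : ℕ) : Finite (OkadaDiagram N) := by
  let heights (D : OkadaDiagram N) (a : ArcNode N) : Fin (N + 1) :=
    ⟨D.val.height a, by
      obtain ⟨b, hb, -⟩ := D.property.matching a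
      have := D.property.height_le a b hb
      have := pos_level a
      omega⟩
  refine Finite.of_injective heights fun C D e => Subtype.ext ?_
  exact C.property.eq_of_height_eq D.property
    (funext fun a => congrArg Fin.val (congrFun e a))

theorem card_maximalAbove_le_card_hasTop {k : ℕ} (hk : k < N) (j : Fin N) (hj : j.val ≤ k) :
    {D : OkadaDiagram N | MaximalAbove D.val.height k}.ncard ≤
      {D : OkadaDiagram N | HasTop D.val.height (k + 1) j}.ncard := by
  induction n_eq : k - j.val generalizing j with
  | zero =>
    refine Set.ncard_le_ncard (fun D hD => ?_) (Set.toFinite _)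
    refine ⟨fun a ha => hD a (by omega), by omega, hk, hD (Sum.inl j) ?_, fun l hl hlk => ?_⟩
    · dsimp only [ArcNode.level]
      omega
    · rw [Fin.lt_def] at hl
      omega
  | succ n ih =>
    let i : Fin (N - 1) := ⟨j.val, by omega⟩
    refine (ih ⟨i.val + 1, by omega⟩ (by dsimp only [i]; omega) (by dsimp only [i]; omega)).trans ?_
    exact Set.ncard_le_ncard_of_injOn (fun D => ⟨comp (gArcs i) D.val, D.property.gArcs_comp i⟩)
      (fun D top => HasTop.gArcs_comp top D.property)
      (fun C topC D topD e => Subtype.ext (HasTop.eq_of_gArcs_comp_eq topC topD C.property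
        D.property (congrArg Subtype.val e))) (Set.toFinite _)

theorem factorial_le_card_maximalAbove {k : ℕ} (hk : k ≤ N) :
    k.factorial ≤ {D : OkadaDiagram N | MaximalAbove D.val.height k}.ncard := by
  induction k with
  | zero => exact (Set.ncard_pos (Set.toFinite _)).2 ⟨OkadaDiagram.id N, fun a _ => rfl⟩
  | succ k ih =>
    let tops (j : Fin (k + 1)) : Set (OkadaDiagram N) :=
      {D | HasTop D.val.height (k + 1) (Fin.castLE hk j)}
    have disjoint : Pairwise (Function.onFun Disjoint tops) := fun i j hij =>
      Set.disjoint_left.2 fun D hi hj => hij (Fin.castLE_injective hk (hi.unique hj))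
    calc (k + 1).factorial = ∑ _ : Fin (k + 1), k.factorial := by simp [Nat.factorial_succ]
      _ ≤ ∑ j, (tops j).ncard := Finset.sum_le_sum fun j _ => (ih (by omega)).trans
        (card_maximalAbove_le_card_hasTop hk _ (Nat.le_of_lt_succ j.isLt))
      _ = (⋃ j, tops j).ncard := by
        rw [Set.ncard_iUnion_of_finite (fun j => Set.toFinite (tops j)) disjoint,
          finsum_eq_sum_of_fintype]
      _ ≤ _ := Set.ncard_le_ncard (Set.iUnion_subset fun j D top => top.above) (Set.toFinite _)

theorem factorial_le_card (N : ℕ) : N.factorial ≤ Nat.card (OkadaDiagram N) :=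
  (factorial_le_card_maximalAbove le_rfl).trans (Set.ncard_le_card _)

end OkadaDiagram

/-! ### Words in the generators -/

section Words

open Submodule

variable {R A : Type*} [CommSemiring R] [Semiring A] [Algebra R A]

/-- The product `E (b - 1) * ⋯ * E (a + 1) * E a`. -/
def descend (E : ℕ → A) (a b : ℕ) : A :=
  ((List.Ico a b).reverse.map E).prod

/-- The `n!` products `descend E a₀ 0 * descend E a₁ 1 * ⋯ * descend E aₙ₋₁ (n - 1)` with `aᵢ ≤ i`,
which span the Okada algebra of rank `n`. -/
def okadaWords (E : ℕ → A) : ℕ → List A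
  | 0 => [1]
  | n + 1 => (okadaWords E n).flatMap fun w =>
      (List.range (n + 1)).map fun a => w * descend E a n

/-- The span of `okadaWords E n`. -/
def okadaWordSpan (R : Type*) {A : Type*} [CommSemiring R] [Semiring A] [Algebra R A] (E : ℕ → A)
    (n : ℕ) : Submodule R A :=
  span R {w | w ∈ okadaWords E n}

/-- The relations of the Okada algebra, for sequences that are indexed by the natural numbers. -/
structure IsOkadaSequence (x y : ℕ → R) (E : ℕ → A) : Prop where
  mul_self : ∀ i, E i * E i = x i • E i
  commute : ∀ i j, i + 2 ≤ j → Commute (E i) (E j)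
  shift : ∀ i, E (i + 1) * E i * E (i + 1) = y i • E (i + 1)

theorem length_okadaWords (E : ℕ → A) (n : ℕ) : (okadaWords E n).length = n.factorial := by
  induction n with
  | zero => rfl
  | succ n ih => simp [okadaWords, ih, Nat.factorial_succ, mul_comm]

theorem descend_self (E : ℕ → A) (a : ℕ) : descend E a a = 1 := by
  simp [descend]

theorem descend_succ (E : ℕ → A) (a : ℕ) : descend E a (a + 1) = E a := by
  simp [descend]

theorem descend_mul_descend (E : ℕ → A) {a b c : ℕ} (hab : a ≤ b) (hbc : b ≤ c) :
    descend E b c * descend E a b = descend E a c := by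
  rw [descend, descend, descend, ← List.Ico.append_consecutive hab hbc, List.reverse_append,
    List.map_append, List.prod_append]

theorem descend_commute {E : ℕ → A} {a b : ℕ} {z : A}
    (hz : ∀ i, a ≤ i → i < b → Commute (E i) z) : Commute (descend E a b) z :=
  Commute.list_prod_left _ _ fun w hw => by
    obtain ⟨i, hi, rfl⟩ := List.mem_map.1 hw
    rw [List.mem_reverse, List.Ico.mem] at hi
    exact hz i hi.1 hi.2

theorem one_mem_okadaWords (E : ℕ → A) (n : ℕ) : 1 ∈ okadaWords E n := by
  induction n with
  | zero => exact List.mem_singleton_self 1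
  | succ n ih =>
    refine List.mem_flatMap.2 ⟨1, ih, List.mem_map.2 ⟨n, List.self_mem_range_succ, ?_⟩⟩
    rw [descend_self, mul_one]

theorem mul_descend_mem_okadaWordSpan {E : ℕ → A} {n a : ℕ} (ha : a ≤ n) {z : A}
    (hz : z ∈ okadaWordSpan R E n) : z * descend E a n ∈ okadaWordSpan R E (n + 1) := by
  refine (span_le (p := (okadaWordSpan R E (n + 1)).comap
    (LinearMap.mulRight R (descend E a n)))).2 (fun w hw => subset_span ?_) hz
  exact List.mem_flatMap.2 ⟨w, hw, List.mem_map.2 ⟨a, List.mem_range.2 (by omega), rfl⟩⟩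

theorem mul_descend_mem {E : ℕ → A} {S : Submodule R A} {a b : ℕ}
    (mul_mem : ∀ i, i < b → ∀ w ∈ S, w * E i ∈ S) {z : A} (hz : z ∈ S) :
    z * descend E a b ∈ S := by
  suffices ∀ l : List ℕ, (∀ i ∈ l, i < b) → ∀ z ∈ S, z * (l.map E).prod ∈ S from
    this _ (fun i hi => (List.Ico.mem.1 (List.mem_reverse.1 hi)).2) z hz
  intro l
  induction l with
  | nil => simp
  | cons i l ih =>
    intro hl z hz
    rw [List.map_cons, List.prod_cons, ← mul_assoc]
    exact ih (fun j hj => hl j (List.mem_cons_of_mem i hj)) _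
      (mul_mem i (hl i List.mem_cons_self) z hz)

namespace IsOkadaSequence

variable {x y : ℕ → R} {E : ℕ → A}

theorem descend_mul_of_lt (rel : IsOkadaSequence x y E) {a i n : ℕ} (hai : a ≤ i)
    (hin : i + 1 < n) :
    descend E a n * E (i + 1) = y i • (descend E a i * descend E (i + 1) n) := by
  have split : descend E a n = descend E (i + 2) n * E (i + 1) * E i * descend E a i := by
    rw [← descend_succ E (i + 1), ← descend_succ E i, descend_mul_descend, descend_mul_descend,
      descend_mul_descend] <;> omega
  have commute_succ : Commute (descend E a i) (E (i + 1)) :=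
    descend_commute fun j _ _ => rel.commute j (i + 1) (by omega)
  have commute_descend : Commute (descend E (i + 1) n) (descend E a i) :=
    descend_commute fun j _ _ => (descend_commute fun k _ _ => rel.commute k j (by omega)).symm
  calc descend E a n * E (i + 1)
      = descend E (i + 2) n * (E (i + 1) * E i * E (i + 1)) * descend E a i := by
        rw [split, mul_assoc _ (descend E a i), commute_succ.eq]
        simp only [mul_assoc]
    _ = y i • (descend E (i + 2) n * descend E (i + 1) (i + 2) * descend E a i) := by
        rw [rel.shift, mul_smul_comm, smul_mul_assoc, descend_succ]
    _ = y i • (descend E a i * descend E (i + 1) n) := by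
        rw [descend_mul_descend _ (by omega) (by omega), commute_descend.eq]

theorem descend_mul_of_eq (rel : IsOkadaSequence x y E) {i n : ℕ} (hin : i < n) :
    descend E i n * E i = x i • descend E i n := by
  rw [← descend_mul_descend E i.le_succ hin, Nat.succ_eq_add_one, descend_succ, mul_assoc,
    rel.mul_self, mul_smul_comm]

theorem mul_mem_okadaWordSpan (rel : IsOkadaSequence x y E) {n i : ℕ} (hi : i + 1 < n) {w : A}
    (hw : w ∈ okadaWordSpan R E n) : w * E i ∈ okadaWordSpan R E n := by
  induction n generalizing i w with
  | zero => omega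
  | succ n ih =>
    suffices ∀ v ∈ okadaWords E (n + 1), v * E i ∈ okadaWordSpan R E (n + 1) from
      (span_le (p := (okadaWordSpan R E (n + 1)).comap (LinearMap.mulRight R (E i)))).2 this hw
    intro v hv
    obtain ⟨w, w_mem, hv⟩ := List.mem_flatMap.1 hv
    obtain ⟨a, ha, rfl⟩ := List.mem_map.1 hv
    rw [List.mem_range] at ha
    have hw : w ∈ okadaWordSpan R E n := subset_span w_mem
    rw [mul_assoc]
    obtain hia | rfl | rfl | hai : i + 1 < a ∨ a = i + 1 ∨ a = i ∨ a < i := by omega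
    · have commute : Commute (descend E a n) (E i) :=
        descend_commute fun j _ _ => (rel.commute i j (by omega)).symm
      rw [commute.eq, ← mul_assoc]
      exact mul_descend_mem_okadaWordSpan (by omega) (ih (by omega) hw)
    · rw [← descend_succ E i, descend_mul_descend E i.le_succ (by omega)]
      exact mul_descend_mem_okadaWordSpan (by omega) hw
    · rw [rel.descend_mul_of_eq (by omega), mul_smul_comm]
      exact smul_mem _ _ (mul_descend_mem_okadaWordSpan (by omega) hw)
    · obtain ⟨i, rfl⟩ := Nat.exists_eq_succ_of_ne_zero (Nat.ne_zero_of_lt hai)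
      rw [Nat.succ_eq_add_one, rel.descend_mul_of_lt (by omega) (by omega), mul_smul_comm,
        ← mul_assoc]
      exact smul_mem _ _ (mul_descend_mem_okadaWordSpan (by omega)
        (mul_descend_mem (fun j hj v hv => ih (by omega) hv) hw))

end IsOkadaSequence

end Words

/-! ### Products of elementary diagrams -/

namespace LabelledArcs

open ArcNode OkadaDiagram

section Weight

variable {N : ℕ} {K : Type*} [Field K] (X : Fin (N - 1) → K) (Y : Fin (N - 2) → K)
  {C D E : LabelledArcs N}

theorem coe_yExp (hC : C.IsOkada) (hD : D.IsOkada) (k : ℕ) : (yExp C D k : ℤ) = yExpInt C D k :=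
  Int.toNat_of_nonneg (yExpInt_nonneg hC hD k)

theorem yExp_cocycle (hC : C.IsOkada) (hD : D.IsOkada) (hE : E.IsOkada) (i : ℕ) :
    yExp C D i + yExp (comp C D) E i = yExp D E i + yExp C (comp D E) i := by
  rw [← Int.natCast_inj]
  simpa only [Nat.cast_add, coe_yExp, hC, hD, hE, hC.comp, hD.comp] using yExpInt_cocycle C D E i

theorem weight_cocycle (hC : C.IsOkada) (hD : D.IsOkada) (hE : E.IsOkada) :
    weight X Y C D * weight X Y (comp C D) E = weight X Y D E * weight X Y C (comp D E) := by
  simp only [weight]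
  rw [mul_mul_mul_comm, mul_mul_mul_comm (∏ k, X k ^ loops D E (k.val + 1))]
  simp only [← Finset.prod_mul_distrib, ← pow_add, loops_cocycle, yExp_cocycle hC hD hE]

theorem weight_eq_one (loops_eq : ∀ k, loops C D k = 0) (yExpInt_eq : ∀ k, yExpInt C D k = 0) :
    weight X Y C D = 1 := by
  have yExp_eq (k : ℕ) : yExp C D k = 0 := congrArg Int.toNat (yExpInt_eq k)
  simp [weight, loops_eq, yExp_eq]

end Weight

section Generators

variable {N : ℕ} {i j : Fin (N - 1)}

theorem isOkada_gArcs (i : Fin (N - 1)) : (gArcs i).IsOkada := (g i).property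

theorem isOkadaPairing_gArcs (i : Fin (N - 1)) :
    IsOkadaPairing (cap i Sum.swap) (gArcs i).height :=
  ((isOkada_gArcs i).eq_ofPairing fun _ _ => cap_swap_of_gArcs_adj).1

theorem gArcs_eq_ofPairing (i : Fin (N - 1)) :
    gArcs i = ofPairing (cap i Sum.swap) (gArcs i).height :=
  ((isOkada_gArcs i).eq_ofPairing fun _ _ => cap_swap_of_gArcs_adj).2

theorem cap_lower (i : Fin (N - 1)) (σ : ArcNode N → ArcNode N) : cap i σ (lower i) = upper i :=
  if_pos rfl

theorem comp_gArcs_gArcs (i j : Fin (N - 1)) : comp (gArcs i) (gArcs j) =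
    ofPairing (cap i (cap j Sum.swap)) (capHeight i (cap j Sum.swap) (gArcs j).height) := by
  rw [gArcs_eq_ofPairing j]
  exact gArcs_comp (isOkadaPairing_gArcs j)

theorem capHeight_eq_ite {σ : ArcNode N → ArcNode N} {h : ArcNode N → ℕ} (l : IsOkadaPairing σ h)
    (i : Fin (N - 1)) (a : ArcNode N) : capHeight i σ h a =
      if a = lower i ∨ a = upper i then i.val + 1
      else if a = σ (lower i) ∨ a = σ (upper i) then min (h (lower i)) (h (upper i))
      else h a := by
  simp only [capHeight, l.eq_iff]

theorem gArcs_height_of_level_ne {a : ArcNode N} (ha : a.level ≠ i.val + 2) :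
    (gArcs i).height a = a.level :=
  if_neg ha

theorem gArcs_height_lower_of_ne (hij : i.val ≠ j.val + 1) :
    (gArcs j).height (lower i) = i.val + 1 :=
  gArcs_height_of_level_ne (by rw [level_lower]; omega)

theorem gArcs_height_upper_of_ne (hij : i ≠ j) : (gArcs j).height (upper i) = i.val + 2 :=
  gArcs_height_of_level_ne (by rw [level_upper]; omega)

theorem cap_swap_lower_of_ne (hij : i ≠ j) (hij_succ : i.val ≠ j.val + 1) :
    cap j Sum.swap (lower i) = Sum.inr ⟨i.val, by omega⟩ :=
  cap_swap_of_gArcs_adj (gArcs_adj_inl_inr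
    (by simpa [lower, Fin.ext_iff] using hij) (by simpa [upper] using hij_succ))

theorem cap_swap_upper_of_ne (hij : i ≠ j) (hij_succ : j.val ≠ i.val + 1) :
    cap j Sum.swap (upper i) = Sum.inr ⟨i.val + 1, by omega⟩ :=
  cap_swap_of_gArcs_adj (gArcs_adj_inl_inr
    (by simpa [lower, eq_comm] using hij_succ) (by simpa [upper, Fin.ext_iff] using hij))

theorem upper_eq_lower (hij : j.val = i.val + 1) : upper i = lower j := by
  simp [upper, lower, hij]

theorem gArcs_comp_self (i : Fin (N - 1)) : comp (gArcs i) (gArcs i) = gArcs i := by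
  have l := isOkadaPairing_gArcs i
  refine ((isOkada_gArcs i).comp (isOkada_gArcs i)).eq_of_height_eq (isOkada_gArcs i) ?_
  rw [comp_gArcs_gArcs]
  funext a
  change capHeight i _ _ a = _
  have partner_upper : cap i Sum.swap (upper i) = lower i := (l.eq_iff.1 (cap_lower i _)).symm
  rw [capHeight_eq_ite l, cap_lower, partner_upper]
  have := gArcs_height_lower i
  have := gArcs_height_upper i
  grind

theorem height_gArcs_comp_gArcs_of_far (hij : i.val + 2 ≤ j.val ∨ j.val + 2 ≤ i.val)
    (a : ArcNode N) : (comp (gArcs i) (gArcs j)).height a =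
      if a.level = i.val + 2 then i.val + 1 else if a.level = j.val + 2 then j.val + 1
      else a.level := by
  rw [comp_gArcs_gArcs]
  change capHeight i _ _ a = _
  rw [capHeight_eq_ite (isOkadaPairing_gArcs j), gArcs_height_lower_of_ne (by omega),
    gArcs_height_upper_of_ne (by omega), cap_swap_lower_of_ne (by omega) (by omega),
    cap_swap_upper_of_ne (by omega) (by omega)]
  rcases a with a | a <;> simp [lower, upper, Fin.ext_iff, gArcs, ArcNode.level] <;> grind

theorem gArcs_comp_comm (hij : i.val + 2 ≤ j.val ∨ j.val + 2 ≤ i.val) :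
    comp (gArcs i) (gArcs j) = comp (gArcs j) (gArcs i) := by
  refine ((isOkada_gArcs i).comp (isOkada_gArcs j)).eq_of_height_eq
    ((isOkada_gArcs j).comp (isOkada_gArcs i)) ?_
  funext a
  rw [height_gArcs_comp_gArcs_of_far hij, height_gArcs_comp_gArcs_of_far hij.symm]
  split_ifs <;> omega

theorem gArcs_height_inr_of_succ (hij : j.val = i.val + 1) :
    (gArcs j).height (Sum.inr ⟨i.val, by omega⟩) = i.val + 1 :=
  gArcs_height_of_level_ne (by simp only [ArcNode.level]; omega)

theorem capHeight_gArcs_of_succ (hij : j.val = i.val + 1) (a : ArcNode N) :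
    capHeight i (cap j Sum.swap) (gArcs j).height a =
      if a = lower j ∨ a = upper j then i.val + 1 else (gArcs j).height a := by
  rw [capHeight_eq_ite (isOkadaPairing_gArcs j), gArcs_height_upper_of_ne (by omega),
    cap_swap_lower_of_ne (by omega) (by omega), upper_eq_lower hij, cap_lower]
  have := gArcs_height_lower_of_ne (i := i) (j := j) (by omega)
  have := gArcs_height_inr_of_succ hij
  grind

theorem cap_cap_swap_lower (hij : j.val = i.val + 1) :
    cap i (cap j Sum.swap) (lower j) = lower i := by
  rw [← upper_eq_lower hij]
  exact (((isOkadaPairing_gArcs j).cap i).eq_iff.1 (cap_lower i _)).symm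

theorem cap_cap_swap_upper (hij : j.val = i.val + 1) :
    cap i (cap j Sum.swap) (upper j) = Sum.inr ⟨i.val, by omega⟩ := by
  have swap_upper : cap j Sum.swap (upper j) = upper i :=
    (upper_eq_lower hij).symm ▸ ((isOkadaPairing_gArcs j).eq_iff.1 (cap_lower j _)).symm
  have lower_ne_upper_succ : lower i ≠ upper j := by
    simp only [lower, upper, ne_eq, Sum.inl.injEq, Fin.mk.injEq]
    omega
  have := lower_ne_upper i
  have := lower_ne_upper j
  have := upper_eq_lower hij
  rw [← cap_swap_lower_of_ne (i := i) (j := j) (by omega) (by omega), cap]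
  grind

theorem gArcs_comp_gArcs_comp_gArcs (hij : j.val = i.val + 1) :
    comp (gArcs j) (comp (gArcs i) (gArcs j)) = gArcs j := by
  have l := (isOkadaPairing_gArcs j).cap i
  refine ((isOkada_gArcs j).comp ((isOkada_gArcs i).comp (isOkada_gArcs j))).eq_of_height_eq
    (isOkada_gArcs j) ?_
  rw [comp_gArcs_gArcs, gArcs_comp l]
  funext a
  change capHeight j _ _ a = _
  rw [capHeight_eq_ite l, cap_cap_swap_lower hij, cap_cap_swap_upper hij]
  simp only [capHeight_gArcs_of_succ hij]
  have := gArcs_height_lower j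
  have := gArcs_height_upper j
  have := gArcs_height_lower_of_ne (i := i) (j := j) (by omega)
  have := gArcs_height_inr_of_succ hij
  grind

end Generators

section GeneratorWeights

variable {N : ℕ} {K : Type*} [Field K] (X : Fin (N - 1) → K) (Y : Fin (N - 2) → K)
  {i j : Fin (N - 1)}

theorem weight_gArcs_self (i : Fin (N - 1)) : weight X Y (gArcs i) (gArcs i) = X i := by
  have l := isOkadaPairing_gArcs i
  have loops_eq := loops_gArcs_of_eq l (cap_lower i _)
  have yExpInt_eq := yExpInt_gArcs_of_eq l (cap_lower i _)
  rw [← gArcs_eq_ofPairing, gArcs_height_lower] at loops_eq yExpInt_eq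
  have yExp_eq (k : ℕ) : yExp (gArcs i) (gArcs i) k = 0 :=
    congrArg Int.toNat ((yExpInt_eq k).trans (if_neg (by omega)))
  simp [weight, loops_eq, yExp_eq, Fin.val_inj, Finset.prod_ite_eq', pow_ite]

theorem weight_gArcs_of_ne (hij : i ≠ j) : weight X Y (gArcs i) (gArcs j) = 1 := by
  have l := isOkadaPairing_gArcs j
  have partner_ne : cap j Sum.swap (lower i) ≠ upper i := fun e => by
    have height_eq := l.height_partner (lower i)
    have le_level := l.le_level (lower i)
    rw [e, gArcs_height_upper_of_ne hij] at height_eq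
    rw [level_lower] at le_level
    omega
  rw [gArcs_eq_ofPairing j]
  refine weight_eq_one X Y (loops_gArcs_of_ne l partner_ne) fun k => ?_
  rw [yExpInt_gArcs_of_ne l partner_ne, gArcs_height_upper_of_ne hij, if_neg (by omega)]

theorem weight_gArcs_comp_gArcs (hij : j.val = i.val + 1) {m : Fin (N - 2)}
    (hm : i.val = m.val) : weight X Y (gArcs j) (comp (gArcs i) (gArcs j)) = Y m := by
  have l := (isOkadaPairing_gArcs j).cap i
  have partner_ne : cap i (cap j Sum.swap) (lower j) ≠ upper j := by
    rw [cap_cap_swap_lower hij]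
    simp [lower, upper]
    omega
  have loops_eq := loops_gArcs_of_ne l partner_ne
  have yExpInt_eq := yExpInt_gArcs_of_ne l partner_ne
  rw [← comp_gArcs_gArcs] at loops_eq yExpInt_eq
  rw [capHeight_gArcs_of_succ hij, capHeight_gArcs_of_succ hij, if_pos (Or.inl rfl),
    if_pos (Or.inr rfl), max_self] at yExpInt_eq
  have yExp_eq (k : Fin (N - 2)) :
      yExp (gArcs j) (comp (gArcs i) (gArcs j)) (k.val + 1) = if k = m then 1 else 0 := by
    refine (congrArg Int.toNat (yExpInt_eq _)).trans ?_
    split_ifs <;> simp <;> omega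
  simp [weight, loops_eq, yExp_eq, pow_ite, Finset.prod_ite_eq']

end GeneratorWeights

end LabelledArcs

/-! ### The isomorphism -/

namespace OkArc

open LabelledArcs OkadaDiagram

variable {K : Type*} [Field K] {N : ℕ} {X : Fin (N - 1) → K} {Y : Fin (N - 2) → K}

theorem diagram_mul_diagram (C D : OkadaDiagram N) :
    diagram X Y C * diagram X Y D =
      weight X Y C.1 D.1 • diagram X Y ⟨comp C.1 D.1, C.2.comp D.2⟩ := by
  have mulHom_diagram : mulHom X Y (diagram X Y C) = Finsupp.linearCombination K
      (mulDiagram X Y C) :=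
    (Finsupp.linearCombination_single K 1 C).trans (one_smul K _)
  calc mulHom X Y (diagram X Y C) (diagram X Y D)
      = Finsupp.linearCombination K (mulDiagram X Y C) (Finsupp.single D 1) :=
        LinearMap.congr_fun mulHom_diagram _
    _ = mulDiagram X Y C D :=
        (Finsupp.linearCombination_single K 1 D).trans (one_smul K _)
    _ = _ := dif_pos (C.2.comp D.2)

@[elab_as_elim]
theorem induction_on {motive : OkArc N X Y → Prop} (a : OkArc N X Y) (zero : motive 0)
    (add : ∀ a b, motive a → motive b → motive (a + b))
    (smul_diagram : ∀ (r : K) D, motive (r • diagram X Y D)) : motive a := by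
  refine Finsupp.induction_linear (motive := motive) a zero (fun a b => add a b) fun D r => ?_
  have single_eq : Finsupp.single D r = r • diagram X Y D :=
    ((Finsupp.smul_single (M := K) r D 1).trans (by rw [smul_eq_mul, mul_one])).symm
  exact single_eq ▸ smul_diagram r D

theorem diagram_mul_assoc (C D E : OkadaDiagram N) :
    diagram X Y C * diagram X Y D * diagram X Y E =
      diagram X Y C * (diagram X Y D * diagram X Y E) := by
  have comp_eq : (⟨comp (comp C.1 D.1) E.1, (C.2.comp D.2).comp E.2⟩ : OkadaDiagram N) =
      ⟨comp C.1 (comp D.1 E.1), C.2.comp (D.2.comp E.2)⟩ :=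
    Subtype.ext (comp_assoc _ _ _)
  simp only [diagram_mul_diagram, smul_mul_assoc, mul_smul_comm, smul_smul, comp_eq,
    weight_cocycle X Y C.2 D.2 E.2]

protected theorem mul_assoc (a b c : OkArc N X Y) : a * b * c = a * (b * c) := by
  induction a using induction_on with
  | zero => simp only [zero_mul]
  | add a a' ha ha' => simp only [add_mul, ha, ha']
  | smul_diagram r C =>
  induction b using induction_on with
  | zero => simp only [zero_mul, mul_zero]
  | add b b' hb hb' => simp only [add_mul, mul_add, hb, hb']
  | smul_diagram s D =>
  induction c using induction_on with
  | zero => simp only [mul_zero]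
  | add c c' hc hc' => simp only [mul_add, hc, hc']
  | smul_diagram t E => simp only [smul_mul_assoc, mul_smul_comm, diagram_mul_assoc]

protected theorem one_mul (a : OkArc N X Y) : 1 * a = a := by
  induction a using induction_on with
  | zero => exact mul_zero _
  | add a b ha hb => rw [mul_add, ha, hb]
  | smul_diagram r D =>
    rw [mul_smul_comm]
    change r • (diagram X Y (OkadaDiagram.id N) * diagram X Y D) = _
    rw [diagram_mul_diagram, weight_eq_one X Y (loops_id D) (yExpInt_id D), one_smul]
    congr 2
    exact Subtype.ext (id_comp D)

protected theorem mul_one (a : OkArc N X Y) : a * 1 = a := by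
  induction a using induction_on with
  | zero => exact zero_mul _
  | add a b ha hb => rw [add_mul, ha, hb]
  | smul_diagram r D =>
    rw [smul_mul_assoc]
    change r • (diagram X Y D * diagram X Y (OkadaDiagram.id N)) = _
    rw [diagram_mul_diagram, weight_eq_one X Y (loops_id_right D.2) (yExpInt_id_right D.2),
      one_smul]
    congr 2
    exact Subtype.ext (comp_id D.2)

variable (X Y)

/-- The ring `OkArc_N(X, Y)`, which provides the target of the universal property of the Okada
algebra. -/
noncomputable abbrev ring : Ring (OkArc N X Y) where
  __ := (inferInstance : NonUnitalNonAssocRing (OkArc N X Y))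
  __ := (inferInstance : One (OkArc N X Y))
  mul_assoc := OkArc.mul_assoc
  one_mul := OkArc.one_mul
  mul_one := OkArc.mul_one

/-- The unital algebra `OkArc_N(X, Y)` over the ring structure `OkArc.ring`. -/
noncomputable abbrev algebra : @Algebra K (OkArc N X Y) _ (ring X Y).toSemiring :=
  letI := ring X Y
  Algebra.ofModule smul_mul_assoc fun r a b => mul_smul_comm r a b

theorem diagram_g_mul_self (i : Fin (N - 1)) :
    diagram X Y (g i) * diagram X Y (g i) = X i • diagram X Y (g i) := by
  rw [diagram_mul_diagram]
  congr 1
  · exact weight_gArcs_self X Y i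
  · congr 1
    exact Subtype.ext (gArcs_comp_self i)

theorem diagram_g_comm {i j : Fin (N - 1)} (hij : i.val + 2 ≤ j.val ∨ j.val + 2 ≤ i.val) :
    diagram X Y (g i) * diagram X Y (g j) = diagram X Y (g j) * diagram X Y (g i) := by
  have ne : i ≠ j := by omega
  rw [diagram_mul_diagram, diagram_mul_diagram]
  congr 1
  · exact (weight_gArcs_of_ne X Y ne).trans (weight_gArcs_of_ne X Y ne.symm).symm
  · congr 1
    exact Subtype.ext (gArcs_comp_comm hij)

theorem diagram_g_shift {i j : Fin (N - 1)} (hij : j.val = i.val + 1) {m : Fin (N - 2)}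
    (hm : i.val = m.val) :
    diagram X Y (g j) * diagram X Y (g i) * diagram X Y (g j) = Y m • diagram X Y (g j) := by
  have weight_eq : weight X Y (g i).1 (g j).1 = 1 := weight_gArcs_of_ne X Y (by omega)
  rw [OkArc.mul_assoc, diagram_mul_diagram (g i), weight_eq, one_smul, diagram_mul_diagram]
  congr 1
  · exact weight_gArcs_comp_gArcs X Y hij hm
  · congr 1
    exact Subtype.ext (gArcs_comp_gArcs_comp_gArcs hij)

variable {X Y}

@[elab_as_elim]
theorem diagram_induction {motive : OkArc N X Y → Prop} (D : OkadaDiagram N) (one : motive 1)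
    (g_mul : ∀ i a, motive a → motive (diagram X Y (g i) * a)) : motive (diagram X Y D) := by
  obtain ⟨D, hD⟩ := D
  induction hD using IsOkada.induction with
  | id => exact one
  | gArcs_comp i D hD loops_eq yExpInt_eq ih =>
    have motive_mul := g_mul i _ ih
    rwa [diagram_mul_diagram,
      show weight X Y (g i).1 D = 1 from weight_eq_one X Y loops_eq yExpInt_eq,
      one_smul] at motive_mul

variable (X Y)

theorem adjoin_eq_top : NonUnitalAlgebra.adjoin K
    (insert 1 (Set.range fun i => diagram X Y (g i))) = ⊤ := by
  refine eq_top_iff.2 fun a _ => ?_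
  induction a using induction_on with
  | zero => exact zero_mem _
  | add a b ha hb => exact add_mem (ha trivial) (hb trivial)
  | smul_diagram r D =>
    refine SMulMemClass.smul_mem r (diagram_induction D ?_ fun i a ha => ?_)
    · exact NonUnitalAlgebra.subset_adjoin K (Set.mem_insert _ _)
    · exact mul_mem (NonUnitalAlgebra.subset_adjoin K (Set.mem_insert_of_mem _ ⟨i, rfl⟩)) ha

theorem finrank_eq_card : Module.finrank K (OkArc N X Y) = Nat.card (OkadaDiagram N) := by
  have := Fintype.ofFinite (OkadaDiagram N)
  rw [Nat.card_eq_fintype_card]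
  exact Module.finrank_finsupp_self K

instance : Module.Finite K (OkArc N X Y) :=
  inferInstanceAs (Module.Finite K (OkadaDiagram N →₀ K))

end OkArc

theorem extend_val_of_lt {M : Type*} [Zero M] {n i : ℕ} (f : Fin n → M) (hi : i < n) :
    Function.extend Fin.val f (0 : ℕ → M) i = f ⟨i, hi⟩ :=
  Fin.val_injective.extend_apply f _ ⟨i, hi⟩

theorem extend_val_of_le {M : Type*} [Zero M] {n i : ℕ} (f : Fin n → M) (hi : n ≤ i) :
    Function.extend Fin.val f (0 : ℕ → M) i = 0 :=
  Function.extend_apply' f _ i fun ⟨j, hj⟩ => hi.not_gt (hj ▸ j.isLt)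

namespace OkadaAlgebra

open OkadaDiagram

variable {K : Type*} [Field K] {N : ℕ} (X : Fin (N - 1) → K) (Y : Fin (N - 2) → K)

theorem e_mul_self (i : Fin (N - 1)) : e X Y i * e X Y i = X i • e X Y i := by
  simpa only [e, map_mul, map_smul] using RingQuot.mkAlgHom_rel K (OkadaRel.sq (Y := Y) (X := X) i)

theorem e_comm {i j : Fin (N - 1)} (hij : i.val + 2 ≤ j.val ∨ j.val + 2 ≤ i.val) :
    e X Y i * e X Y j = e X Y j * e X Y i := by
  simpa only [e, map_mul] using RingQuot.mkAlgHom_rel K (OkadaRel.comm (Y := Y) (X := X) i j hij)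

theorem e_shift {m : Fin (N - 2)} {i j : Fin (N - 1)} (hi : i.val = m.val)
    (hj : j.val = m.val + 1) : e X Y j * e X Y i * e X Y j = Y m • e X Y j := by
  simpa only [e, map_mul, map_smul] using
    RingQuot.mkAlgHom_rel K (OkadaRel.shift (Y := Y) (X := X) m i j hi hj)

variable {X Y} in
@[elab_as_elim]
theorem induction_on {motive : OkadaAlgebra N X Y → Prop} (a : OkadaAlgebra N X Y)
    (algebraMap : ∀ r : K, motive (algebraMap K _ r)) (e : ∀ i, motive (e X Y i))
    (mul : ∀ a b, motive a → motive b → motive (a * b))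
    (add : ∀ a b, motive a → motive b → motive (a + b)) : motive a := by
  obtain ⟨a, rfl⟩ := RingQuot.mkAlgHom_surjective K (OkadaRel N X Y) a
  induction a using FreeAlgebra.induction with
  | grade0 r => exact AlgHom.commutes (RingQuot.mkAlgHom K (OkadaRel N X Y)) r ▸ algebraMap r
  | grade1 i => exact e i
  | mul a b ha hb => exact map_mul (RingQuot.mkAlgHom K (OkadaRel N X Y)) a b ▸ mul _ _ ha hb
  | add a b ha hb => exact map_add (RingQuot.mkAlgHom K (OkadaRel N X Y)) a b ▸ add _ _ ha hb

theorem isOkadaSequence_extend : IsOkadaSequence (Function.extend Fin.val X 0)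
    (Function.extend Fin.val Y 0) (Function.extend Fin.val (e X Y) 0) where
  mul_self i := by
    obtain hi | hi := lt_or_ge i (N - 1)
    · simp only [extend_val_of_lt _ hi, e_mul_self]
    · simp only [extend_val_of_le _ hi, mul_zero, smul_zero]
  commute i j hij := by
    obtain hj | hj := lt_or_ge j (N - 1)
    · rw [extend_val_of_lt _ hj, extend_val_of_lt _ (by omega : i < N - 1)]
      exact e_comm X Y (Or.inl hij)
    · rw [extend_val_of_le _ hj]
      exact Commute.zero_right _
  shift i := by
    obtain hi | hi := lt_or_ge (i + 1) (N - 1)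
    · rw [extend_val_of_lt _ hi, extend_val_of_lt _ (by omega : i < N - 1),
        extend_val_of_lt _ (by omega : i < N - 2)]
      exact e_shift X Y rfl rfl
    · simp only [extend_val_of_le _ hi, mul_zero, smul_zero]

theorem okadaWordSpan_eq_top :
    okadaWordSpan K (Function.extend Fin.val (e X Y) 0) N = ⊤ := by
  suffices ∀ a, ∀ w ∈ okadaWordSpan K (Function.extend Fin.val (e X Y) 0) N,
      w * a ∈ okadaWordSpan K (Function.extend Fin.val (e X Y) 0) N from
    eq_top_iff.2 fun a _ => one_mul a ▸ this a 1 (Submodule.subset_span (one_mem_okadaWords _ N))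
  intro a
  induction a using induction_on with
  | algebraMap r =>
    intro w hw
    rw [← Algebra.commutes, ← Algebra.smul_def]
    exact Submodule.smul_mem _ _ hw
  | e i =>
    intro w hw
    rw [← extend_val_of_lt (e X Y) i.isLt]
    exact (isOkadaSequence_extend X Y).mul_mem_okadaWordSpan (by omega) hw
  | mul a b ha hb =>
    intro w hw
    rw [← mul_assoc]
    exact hb _ (ha w hw)
  | add a b ha hb =>
    intro w hw
    rw [mul_add]
    exact add_mem (ha w hw) (hb w hw)

theorem span_range_get_okadaWords : Submodule.span K
    (Set.range (okadaWords (Function.extend Fin.val (e X Y) 0) N).get) = ⊤ := by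
  rw [Set.range_list_get]
  exact okadaWordSpan_eq_top X Y

instance : Module.Finite K (OkadaAlgebra N X Y) :=
  ⟨span_range_get_okadaWords X Y ▸ Submodule.fg_span (Set.finite_range _)⟩

theorem finrank_le : Module.finrank K (OkadaAlgebra N X Y) ≤ N.factorial := by
  have finrank_span_le := finrank_range_le_card (R := K)
    (okadaWords (Function.extend Fin.val (e X Y) 0) N).get
  rwa [Set.finrank, span_range_get_okadaWords, finrank_top, Fintype.card_fin,
    length_okadaWords] at finrank_span_le

theorem exists_hom : ∃ Θ : OkadaAlgebra N X Y →ₙₐ[K] OkArc N X Y, Θ 1 = 1 ∧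
    ∀ i, Θ (e X Y i) = OkArc.diagram X Y (g i) := by
  let _ := OkArc.ring X Y
  let _ := OkArc.algebra X Y
  let f : FreeAlgebra K (Fin (N - 1)) →ₐ[K] OkArc N X Y :=
    FreeAlgebra.lift K fun i => OkArc.diagram X Y (g i)
  have f_ι (i : Fin (N - 1)) : f (FreeAlgebra.ι K i) = OkArc.diagram X Y (g i) :=
    FreeAlgebra.lift_ι_apply _ i
  have f_rel ⦃a b⦄ (hab : OkadaRel N X Y a b) : f a = f b := by
    rcases hab with i | ⟨i, j, hij⟩ | ⟨m, i, j, hi, hj⟩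
    · rw [map_mul, map_smul, f_ι]
      exact OkArc.diagram_g_mul_self X Y i
    · rw [map_mul, map_mul, f_ι, f_ι]
      exact OkArc.diagram_g_comm X Y hij
    · rw [map_mul, map_mul, map_smul, f_ι, f_ι]
      exact OkArc.diagram_g_shift X Y (by omega) hi
  let φ : OkadaAlgebra N X Y →ₐ[K] OkArc N X Y := RingQuot.liftAlgHom K ⟨f, f_rel⟩
  refine ⟨{ toFun := φ, map_smul' := fun r a => map_smul φ r a, map_zero' := map_zero φ,
            map_add' := map_add φ, map_mul' := map_mul φ }, map_one φ, fun i => ?_⟩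
  exact (RingQuot.liftAlgHom_mkAlgHom_apply K f f_rel _).trans (f_ι i)

section Hom

variable {X Y} {Θ Θ' : OkadaAlgebra N X Y →ₙₐ[K] OkArc N X Y}

theorem surjective_of_hom (map_one : Θ 1 = 1)
    (map_e : ∀ i, Θ (e X Y i) = OkArc.diagram X Y (g i)) : Function.Surjective Θ := by
  intro a
  induction a using OkArc.induction_on with
  | zero => exact ⟨0, map_zero Θ⟩
  | add _ _ ha hb =>
    obtain ⟨a, rfl⟩ := ha
    obtain ⟨b, rfl⟩ := hb
    exact ⟨a + b, map_add Θ a b⟩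
  | smul_diagram r D =>
    have diagram_mem : ∃ b, Θ b = OkArc.diagram X Y D := by
      refine OkArc.diagram_induction D ⟨1, map_one⟩ ?_
      rintro i _ ⟨b, rfl⟩
      exact ⟨e X Y i * b, by rw [map_mul, map_e]⟩
    obtain ⟨b, hb⟩ := diagram_mem
    exact ⟨r • b, by rw [map_smul, hb]⟩

theorem hom_ext (map_one : Θ 1 = 1) (map_one' : Θ' 1 = 1)
    (map_e : ∀ i, Θ (e X Y i) = Θ' (e X Y i)) : Θ = Θ' := by
  refine NonUnitalAlgHom.ext fun a => ?_
  induction a using induction_on with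
  | algebraMap r =>
    rw [Algebra.algebraMap_eq_smul_one, map_smul, map_smul, map_one, map_one']
  | e i => exact map_e i
  | mul a b ha hb => rw [map_mul, map_mul, ha, hb]
  | add a b ha hb => rw [map_add, map_add, ha, hb]

theorem finrank_eq_of_surjective (hΘ : Function.Surjective Θ) :
    Module.finrank K (OkadaAlgebra N X Y) = N.factorial ∧
      Module.finrank K (OkArc N X Y) = N.factorial := by
  have upper := finrank_le X Y
  have mid := LinearMap.finrank_le_finrank_of_surjective
    (f := (Θ : OkadaAlgebra N X Y →ₗ[K] OkArc N X Y)) hΘ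
  have lower := factorial_le_card N
  rw [← OkArc.finrank_eq_card X Y] at lower
  omega

theorem bijective_of_surjective (hΘ : Function.Surjective Θ) : Function.Bijective Θ := by
  obtain ⟨finrank_okada, finrank_okArc⟩ := finrank_eq_of_surjective hΘ
  exact ⟨(LinearMap.injective_iff_surjective_of_finrank_eq_finrank
    (finrank_okada.trans finrank_okArc.symm)
    (f := (Θ : OkadaAlgebra N X Y →ₗ[K] OkArc N X Y))).2 hΘ, hΘ⟩

end Hom

end OkadaAlgebra

theorem mainTheorem2 {K : Type*} [Field K] (N : ℕ) (X : Fin (N - 1) → K) (Y : Fin (N - 2) → K) :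
    -- `OkArc_N(X, Y)` is well defined: diagrams are closed under composition, and the product is
    -- associative with the identity diagram as unit
    (∀ C D : OkadaDiagram N, (LabelledArcs.comp C.1 D.1).IsOkada) ∧
    (∀ a b c : OkArc N X Y, a * b * c = a * (b * c)) ∧
    (∀ a : OkArc N X Y, 1 * a = a ∧ a * 1 = a) ∧
    -- the dimension
    Module.finrank K (OkArc N X Y) = N.factorial ∧
    -- generation, as a unital algebra, by the elementary diagrams
    NonUnitalAlgebra.adjoin K
      (insert 1 (Set.range fun i => OkArc.diagram X Y (OkadaDiagram.g i))) = ⊤ ∧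
    -- the isomorphism, and its uniqueness among all unital algebra homomorphisms
    ∃ Θ : OkadaAlgebra N X Y →ₙₐ[K] OkArc N X Y,
      (Function.Bijective Θ ∧ Θ 1 = 1 ∧
        ∀ i, Θ (OkadaAlgebra.e X Y i) = OkArc.diagram X Y (OkadaDiagram.g i)) ∧
      ∀ Θ' : OkadaAlgebra N X Y →ₙₐ[K] OkArc N X Y, Θ' 1 = 1 →
        (∀ i, Θ' (OkadaAlgebra.e X Y i) = OkArc.diagram X Y (OkadaDiagram.g i)) → Θ' = Θ := by
  obtain ⟨Θ, map_one, map_e⟩ := OkadaAlgebra.exists_hom X Y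
  have surjective := OkadaAlgebra.surjective_of_hom map_one map_e
  exact ⟨fun C D => C.2.comp D.2, OkArc.mul_assoc, fun a => ⟨OkArc.one_mul a, OkArc.mul_one a⟩,
    (OkadaAlgebra.finrank_eq_of_surjective surjective).2, OkArc.adjoin_eq_top X Y,
    Θ, ⟨OkadaAlgebra.bijective_of_surjective surjective, map_one, map_e⟩,
    fun Θ' map_one' map_e' =>
      OkadaAlgebra.hom_ext map_one' map_one fun i => (map_e' i).trans (map_e i).symm⟩
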